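/- Let $d\ge 1$, let $\mathbb S^d\subset\mathbb R^{d+1}$ be the unit sphere with its uniform probability measure $\omega$, and let $k:\mathbb S^d\times\mathbb S^d\to\mathbb R$ be a continuous positive semidefinite inner-product kernel, i.e. $k(x,x')=\Phi(\langle x,x'\rangle)$ for some function $\Phi$. Let $T$ be the integral operator $Tf(x)=\int k(x,\xi)f(\xi)\,d\omega(\xi)$ on $L^2(\mathbb S^d,\omega)$. For $n\ge 0$ put $N(d,n)=\binom{n+d}{n}-\binom{n+d-2}{n-2}$, where the second binomial coefficient is $0$ for $n<2$. A spherical harmonic of degree $n$ is the restriction to $\mathbb S^d$ of a homogeneous harmonic polynomial of degree $n$ on $\mathbb R^{d+1}$. (I) (Mercer decomposition.) For every $n$ the space of spherical harmonics of degree $n$ has an orthonormal basis $Y_{n,1},\dots,Y_{n,N(d,n)}$ in $L^2(\mathbb S^d,\omega)$, and there are numbers $\mu_n\ge 0$ $(n\ge 0)$ such that, for every choice of such bases, all the $Y_{n,l}$ together form an orthonormal basis of $L^2(\mathbb S^d,\omega)$, $TY_{n,l}=\mu_nY_{n,l}$, and $$k(x,x')=\sum_{n=0}^\infty\mu_n\sum_{l=1}^{N(d,n)}Y_{n,l}(x)Y_{n,l}(x'),$$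 where the partial sums over $n$ converge uniformly on $\mathbb S^d\times\mathbb S^d$ and the double series converges absolutely at every $(x,x')$. (II) Suppose in addition that $\mu_n\asymp n^{-d\beta}$ as $n\to\infty$ for some $\beta>1$, that is, the quotient of the two sides lies between two positive constants for all large $n$. Then: (a) (Eigenvalue decay.) The nonzero eigenvalues of $T$, counted with multiplicity, form a nonincreasing sequence $\lambda_1\ge\lambda_2\ge\dots>0$, with orthonormal eigenfunctions $e_1,e_2,\dots$ such that $T$ vanishes on the orthogonal complement of $\{e_i\}$, and there are constants $c,C>0$ with $ci^{-\beta}\le\lambda_i\le Ci^{-\beta}$ for all $i\ge1$. (b) (Variance lower bound.) For a function $\varphi$ bounded on the spectrum of $T$ let $\varphi(T)$ be given by the spectral functional calculus of $T$, let $k_x=k(x,\cdot)$, and for $t>0$ put $$C_t(x,x')=\sigma^2\int_{\mathbb S^d}(\varphi_t(T)k_x)(z)\,(\varphi_t(T)k_{x'})(z)\,d\omega(z),$$ where $\varphi_t$ is either the filter function $\varphi_t^{con}(z)=(1-e^{-tz})/z$ of the continuous kernel gradient flow, or the filter function $\varphi_t^{dis}(z)=(1-(1-\eta z)^{t/\eta})/z$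 of the discrete kernel gradient flow with learning rate $\eta$ (with $\varphi_t(0)=t$ in both cases). Then for every $t_0>0$ there is a constant $c>0$ such that $$C_t(x,x)\ge c\,\sigma^2t^{1/\beta}$$ for all $t\ge t_0$, all $x\in\mathbb S^d$ and all $\sigma\in\mathbb R$, both for the continuous filter function and for the discrete filter function with any learning rate $0<\eta<\frac1{2\kappa^2}$, where $\kappa>0$ is any number with $\sup_xk(x,x)\le\kappa^2$. -/

import Mathlib

open MeasureTheory Filter Topology
open scoped InnerProductSpace

noncomputable section

namespace SphereKernel

/-- The unit sphere `𝕊^d` of `ℝ^(d+1)`. -/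
abbrev Sph (d : ℕ) : Type := Metric.sphere (0 : EuclideanSpace ℝ (Fin (d + 1))) 1

/-- The uniform probability measure on `𝕊^d`: the surface measure, normalised to total mass one. -/
def unif (d : ℕ) : Measure (Sph d) :=
  ((volume : Measure (EuclideanSpace ℝ (Fin (d + 1)))).toSphere Set.univ)⁻¹ •
    (volume : Measure (EuclideanSpace ℝ (Fin (d + 1)))).toSphere

instance (d : ℕ) : IsProbabilityMeasure (unif d) := by
  have : NeZero (volume : Measure (EuclideanSpace ℝ (Fin (d + 1)))).toSphere :=
    ⟨Measure.toSphere_ne_zero _⟩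
  unfold unif
  infer_instance

/-- The real Hilbert space `L²(𝕊^d)` of the uniform probability measure. -/
abbrev L2 (d : ℕ) : Type := Lp ℝ 2 (unif d)

/-- The class in `L²(𝕊^d)` of a continuous function. -/
abbrev toL2 {d : ℕ} (f : C(Sph d, ℝ)) : L2 d := ContinuousMap.toLp 2 (unif d) ℝ f

/-! ### Kernels and their integral operators -/

/-- A continuous kernel `K` on `𝕊^d` is a (positive semidefinite) inner-product kernel if it is
positive semidefinite and `K(x, y)` is a function of the inner product `⟪x, y⟫` only. -/
structure IsInnerProductKernel {d : ℕ} (K : C(Sph d × Sph d, ℝ)) : Prop where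
  posSemidef : (Matrix.of fun x y : Sph d => K (x, y)).PosSemidef
  exists_profile : ∃ Φ : ℝ → ℝ, ∀ x y : Sph d,
    K (x, y) = Φ ⟪(x : EuclideanSpace ℝ (Fin (d + 1))), (y : EuclideanSpace ℝ (Fin (d + 1)))⟫_ℝ

/-- The section `k_x = K(x, ·)`. -/
def sec {d : ℕ} (K : C(Sph d × Sph d, ℝ)) (x : Sph d) : C(Sph d, ℝ) := K.curry x

theorem inner_sec {d : ℕ} (K : C(Sph d × Sph d, ℝ)) (f : L2 d) (x : Sph d) :
    ⟪toL2 (sec K x), f⟫_ℝ = ∫ ξ, K (x, ξ) * f ξ ∂(unif d) := by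
  rw [L2.inner_def]
  refine integral_congr_ae ?_
  filter_upwards [ContinuousMap.coeFn_toLp (p := 2) (𝕜 := ℝ) (unif d) (sec K x)] with ξ hξ
  rw [hξ]
  simp [sec, mul_comm]

theorem continuous_integral {d : ℕ} (K : C(Sph d × Sph d, ℝ)) (f : L2 d) :
    Continuous fun x : Sph d => ∫ ξ, K (x, ξ) * f ξ ∂(unif d) := by
  simp_rw [← inner_sec]
  have h : Continuous fun x : Sph d => toL2 (sec K x) :=
    (ContinuousMap.toLp 2 (unif d) ℝ).continuous.comp K.curry.continuous
  exact h.inner continuous_const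

/-- The function `x ↦ ∫ K(x, ξ) f(ξ) dξ`, for `f` in `L²(𝕊^d)`. -/
def integralFun {d : ℕ} (K : C(Sph d × Sph d, ℝ)) (f : L2 d) : C(Sph d, ℝ) :=
  ⟨fun x => ∫ ξ, K (x, ξ) * f ξ ∂(unif d), continuous_integral K f⟩

theorem integralFun_apply {d : ℕ} (K : C(Sph d × Sph d, ℝ)) (f : L2 d) (x : Sph d) :
    integralFun K f x = ⟪toL2 (sec K x), f⟫_ℝ := (inner_sec K f x).symm

/-- `integralFun` as a linear map. -/
def integralLin {d : ℕ} (K : C(Sph d × Sph d, ℝ)) : L2 d →ₗ[ℝ] C(Sph d, ℝ) where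
  toFun := integralFun K
  map_add' f g := by
    ext x
    simp only [ContinuousMap.add_apply, integralFun_apply, inner_add_right]
  map_smul' c f := by
    ext x
    simp only [ContinuousMap.smul_apply, integralFun_apply, inner_smul_right, smul_eq_mul,
      RingHom.id_apply]

theorem norm_integralLin_le {d : ℕ} (K : C(Sph d × Sph d, ℝ)) (f : L2 d) :
    ‖integralLin K f‖ ≤
      ‖(ContinuousMap.toLp 2 (unif d) ℝ : C(Sph d, ℝ) →L[ℝ] L2 d)‖ * ‖K.curry‖ * ‖f‖ := by
  refine (ContinuousMap.norm_le _ (by positivity)).2 fun x => ?_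
  change ‖integralFun K f x‖ ≤ _
  rw [integralFun_apply]
  refine (norm_inner_le_norm _ _).trans ?_
  have h1 : ‖toL2 (sec K x)‖ ≤
      ‖(ContinuousMap.toLp 2 (unif d) ℝ : C(Sph d, ℝ) →L[ℝ] L2 d)‖ * ‖sec K x‖ :=
    ContinuousLinearMap.le_opNorm _ _
  have h2 : ‖sec K x‖ ≤ ‖K.curry‖ := ContinuousMap.norm_coe_le_norm K.curry x
  have h3 := h1.trans (mul_le_mul_of_nonneg_left h2 (ContinuousLinearMap.opNorm_nonneg _))
  exact mul_le_mul_of_nonneg_right h3 (norm_nonneg _)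

/-- The integral operator `T f (x) = ∫ K(x, ξ) f(ξ) dξ` on `L²(𝕊^d)`. -/
def intOp {d : ℕ} (K : C(Sph d × Sph d, ℝ)) : L2 d →L[ℝ] L2 d :=
  (ContinuousMap.toLp 2 (unif d) ℝ).comp
    ((integralLin K).mkContinuous _ (norm_integralLin_le K))

/-! ### Spherical harmonics -/

/-- The homogeneous polynomials of degree `n` in `d + 1` variables with vanishing Laplacian. -/
def harmonicPoly (d n : ℕ) : Submodule ℝ (MvPolynomial (Fin (d + 1)) ℝ) :=
  MvPolynomial.homogeneousSubmodule (Fin (d + 1)) ℝ n ⊓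
    LinearMap.ker (∑ i : Fin (d + 1),
      (MvPolynomial.pderiv (R := ℝ) i).toLinearMap ∘ₗ
        (MvPolynomial.pderiv (R := ℝ) i).toLinearMap)

/-- Restriction of a polynomial to the sphere. -/
def restrict (d : ℕ) : MvPolynomial (Fin (d + 1)) ℝ →ₗ[ℝ] C(Sph d, ℝ) where
  toFun p := ⟨fun x => MvPolynomial.eval (fun i => (x : EuclideanSpace ℝ (Fin (d + 1))) i) p,
    (MvPolynomial.continuous_eval p).comp
      (continuous_pi fun i => (EuclideanSpace.proj i).continuous.comp continuous_subtype_val)⟩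
  map_add' p q := by ext x; simp
  map_smul' c p := by ext x; simp

/-- The space of spherical harmonics of degree `n` on `𝕊^d`. -/
def harmonics (d n : ℕ) : Submodule ℝ C(Sph d, ℝ) := (harmonicPoly d n).map (restrict d)

/-- `N(d, n) = C(n + d, n) - C(n + d - 2, n - 2)`, where the second binomial coefficient is zero
for `n < 2`. -/
def harmDim (d n : ℕ) : ℕ :=
  (n + d).choose n - if 2 ≤ n then (n + d - 2).choose (n - 2) else 0

/-- For each degree `n`, the functions `Y n l`, `l < N(d, n)`, are an orthonormal basis of the
spherical harmonics of degree `n`. -/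
structure IsHarmonicSystem {d : ℕ} (Y : (n : ℕ) → Fin (harmDim d n) → C(Sph d, ℝ)) : Prop where
  orthonormal : ∀ n, Orthonormal ℝ fun l => toL2 (Y n l)
  span_eq : ∀ n, Submodule.span ℝ (Set.range (Y n)) = harmonics d n

/-- `m n` (with multiplicity `N(d, n)`) are the coefficients of a Mercer decomposition of `K` on
spherical harmonics: for every choice of orthonormal bases `Y n` of the spherical harmonics of
degree `n`, all the `Y n l` together form an orthonormal basis of `L²(𝕊^d)` made of eigenfunctions
of the integral operator, with eigenvalues `m n`, and
`K(x, y) = ∑ n, m n * ∑ l, Y n l x * Y n l y` with absolute and uniform convergence. -/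
structure IsMercerCoeff {d : ℕ} (K : C(Sph d × Sph d, ℝ)) (m : ℕ → ℝ) : Prop where
  exists_system : ∃ Y : (n : ℕ) → Fin (harmDim d n) → C(Sph d, ℝ), IsHarmonicSystem Y
  nonneg : ∀ n, 0 ≤ m n
  orthonormal : ∀ Y : (n : ℕ) → Fin (harmDim d n) → C(Sph d, ℝ), IsHarmonicSystem Y →
    Orthonormal ℝ fun i : Σ n, Fin (harmDim d n) => toL2 (Y i.1 i.2)
  complete : ∀ Y : (n : ℕ) → Fin (harmDim d n) → C(Sph d, ℝ), IsHarmonicSystem Y →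
    (Submodule.span ℝ
      (Set.range fun i : Σ n, Fin (harmDim d n) => toL2 (Y i.1 i.2))).topologicalClosure = ⊤
  eigen : ∀ Y : (n : ℕ) → Fin (harmDim d n) → C(Sph d, ℝ), IsHarmonicSystem Y →
    ∀ n l x, ∫ ξ, K (x, ξ) * Y n l ξ ∂(unif d) = m n * Y n l x
  summable_abs : ∀ Y : (n : ℕ) → Fin (harmDim d n) → C(Sph d, ℝ), IsHarmonicSystem Y →
    ∀ x y, Summable fun i : Σ n, Fin (harmDim d n) => |m i.1 * (Y i.1 i.2 x * Y i.1 i.2 y)|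
  tendstoUniformly : ∀ Y : (n : ℕ) → Fin (harmDim d n) → C(Sph d, ℝ), IsHarmonicSystem Y →
    TendstoUniformly
      (fun (M : ℕ) (p : Sph d × Sph d) =>
        ∑ n ∈ Finset.range M, m n * ∑ l, Y n l p.1 * Y n l p.2)
      (fun p => K p) atTop

/-! ### Eigenvalue decay and the variance lower bound -/

/-- The eigenvalue decay `c i^(-β) ≤ λ_i ≤ C i^(-β)`, where `λ_1 ≥ λ_2 ≥ ⋯ > 0` are the nonzero
eigenvalues of the integral operator counted with multiplicity. Here `ev i` is `λ_(i+1)`. The `e i`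
are orthonormal eigenfunctions, and the operator vanishes on their orthogonal complement (so that
they form an orthonormal basis as soon as the operator is injective). -/
def EigenvalueDecay {d : ℕ} (K : C(Sph d × Sph d, ℝ)) (β : ℝ) : Prop :=
  ∃ (ev : ℕ → ℝ) (e : ℕ → L2 d),
    Antitone ev ∧ (∀ i, 0 < ev i) ∧ Orthonormal ℝ e ∧
    (∀ i, intOp K (e i) = ev i • e i) ∧
    (∀ f : L2 d, (∀ i, ⟪e i, f⟫_ℝ = 0) → intOp K f = 0) ∧
    ∃ c C : ℝ, 0 < c ∧ 0 < C ∧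
      ∀ i : ℕ, c * ((i : ℝ) + 1) ^ (-β) ≤ ev i ∧ ev i ≤ C * ((i : ℝ) + 1) ^ (-β)

instance eigenspace_hasOrthogonalProjection {d : ℕ} (T : L2 d →L[ℝ] L2 d) (z : ℝ) :
    (Module.End.eigenspace (T : L2 d →ₗ[ℝ] L2 d) z).HasOrthogonalProjection := by
  have h : IsClosed (Module.End.eigenspace (T : L2 d →ₗ[ℝ] L2 d) z : Set (L2 d)) := by
    have : (Module.End.eigenspace (T : L2 d →ₗ[ℝ] L2 d) z : Set (L2 d)) = {f | T f = z • f} := by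
      ext f
      simp
    rw [this]
    exact isClosed_eq T.continuous (continuous_const_smul z)
  have : CompleteSpace (Module.End.eigenspace (T : L2 d →ₗ[ℝ] L2 d) z) :=
    h.completeSpace_coe
  infer_instance

/-- The functional calculus `φ(T) f = ∑_z φ(z) P_z f` of a compact self-adjoint operator `T`, with
`P_z` the orthogonal projection onto the eigenspace of `z` (which is zero unless `z` is an
eigenvalue). -/
def funcCalc {d : ℕ} (φ : ℝ → ℝ) (T : L2 d →L[ℝ] L2 d) (f : L2 d) : L2 d :=
  ∑' z : ℝ, φ z • (Module.End.eigenspace (T : L2 d →ₗ[ℝ] L2 d) z).starProjection f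

/-- The filter function `(1 - e^(-tz)) / z` of the continuous kernel gradient flow, with its
limit `t` at `z = 0`. -/
def filterCon (t z : ℝ) : ℝ := if z = 0 then t else (1 - Real.exp (-(t * z))) / z

/-- The filter function `(1 - (1 - ηz)^(t/η)) / z` of the discrete kernel gradient flow with
learning rate `η`, with its limit `t` at `z = 0`. -/
def filterDis (η t z : ℝ) : ℝ := if z = 0 then t else (1 - (1 - η * z) ^ (t / η)) / z

/-- `C(x, x') = σ² 𝔼_z[(φ(T) k_x)(z) (φ(T) k_x')(z)]`, with `z` uniform on the sphere, for a
filter function `φ`. -/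
def covC {d : ℕ} (K : C(Sph d × Sph d, ℝ)) (σ : ℝ) (φ : ℝ → ℝ) (x x' : Sph d) : ℝ :=
  σ ^ 2 * ∫ z, funcCalc φ (intOp K) (toL2 (sec K x)) z *
    funcCalc φ (intOp K) (toL2 (sec K x')) z ∂(unif d)

/-- The lower bound `C_t(x, x) ≥ c σ² t^(1/β)`, for the continuous and the discrete kernel
gradient flow. For any `t₀ > 0` the constant `c` is uniform in `t ≥ t₀`, in `x`, in the noise level
`σ` and in all learning rates `0 < η < 1 / (2κ²)`, where `κ²` is a bound of `K(x, x)`. -/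
def VarianceLowerBound {d : ℕ} (K : C(Sph d × Sph d, ℝ)) (β : ℝ) : Prop :=
  ∀ t₀ : ℝ, 0 < t₀ → ∃ c : ℝ, 0 < c ∧ ∀ (σ t : ℝ) (x : Sph d), t₀ ≤ t →
    c * σ ^ 2 * t ^ (1 / β) ≤ covC K σ (filterCon t) x x ∧
    ∀ κ η : ℝ, 0 < κ → (∀ y, K (y, y) ≤ κ ^ 2) → 0 < η → η < 1 / (2 * κ ^ 2) →
      c * σ ^ 2 * t ^ (1 / β) ≤ covC K σ (filterDis η t) x x

end SphereKernel

end

open SphereKernel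

/-!
The proof of the Mercer decomposition rests on the invariance of the uniform measure under
rotations, and everything about spherical harmonics is derived from it algebraically. The generator
`x_i ∂_j - x_j ∂_i` of a rotation has mean zero on the sphere (`mean_rotGen`); summing this identity
gives `∫ Δp = k (k + d - 1) ∫ p` for homogeneous `p` of degree `k` (`mean_lap`). For harmonic `p`,
`q` of different degrees, `Δ(p q) = 2 ∑ ∂_i p ∂_i q` is a sum of products of harmonic polynomials of
different, lower degrees, so that `∫ p q = 0` by induction (`mean_mul_eq_zero`). The orthogonality
makes `q ↦ Δ(|x|² q)` injective, hence bijective, on homogeneous polynomials of a given degree. Thus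
every polynomial is a sum of harmonic ones on the sphere (`restrict_mem_harmonicsLT`), the harmonic
polynomials of degree `n` have dimension `N(d, n)` (`finrank_harmonicPoly`), and by
Stone–Weierstrass the spherical harmonics are complete.

The zonal kernel `Z_n(x, y) = ∑ l, Y_{n,l}(x) Y_{n,l}(y)` is the reproducing kernel of the harmonics
of degree `n`. It is therefore invariant under rotations, so it depends on `⟪x, y⟫` only, and in
fact is a polynomial of degree at most `n` in `⟪x, y⟫` (`IsHarmonicSystem.exists_zonal_eq_eval`). On
the diagonal it is constant, equal to its mean `N(d, n)` (`IsHarmonicSystem.zonal_self`). By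
orthogonality these polynomials are linearly independent, and so they span all polynomials. A kernel
that is a polynomial in `⟪x, y⟫` is thus a combination of zonal kernels, for which every harmonic of
degree `n` is an eigenfunction with an eigenvalue depending on `n` only; Weierstrass approximation
extends this to continuous kernels (`exists_integral_mul_harmonics`). If `K(x, y) = ⟪Ψ(x), Ψ(y)⟫` is
positive semidefinite, Bessel's inequality for `Ψ(x)` gives `μ_n ≥ 0` and `∑ μ_n N(d, n) < ∞`
(`mercer_nonneg_and_bessel`). The Mercer series converges uniformly since `|Z_n| ≤ N(d, n)`, and its
sum is `K` since the two have the same coefficients.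

For the decay of the eigenvalues, the number of harmonics of degree less than `n` lies between
`n^d / d!` and `2 n^d`, so that sorting the `μ_n` with multiplicities turns `n^(-dβ)` into `i^(-β)`
(`IsMercerCoeff.eigenvalueDecay`). For the variance, `⟪Y_{n,l}, φ(T) k_x⟫ = φ(μ_n) μ_n Y_{n,l}(x)`,
whence Bessel's inequality and the value of `Z_n` on the diagonal bound `C_t(x, x)` from below by
`σ² ∑ n, (φ(μ_n) μ_n)² N(d, n)` (`IsMercerCoeff.le_covC`). Both filters satisfy
`φ(z) z ≥ 1 - e^(-tz)`, which is at least `1/2` when `μ_n ≥ 1/t`, and this is the case for about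
`t^(1/β)` harmonics (`exists_sum_one_sub_exp_ge`).
-/

noncomputable section

namespace SphereKernel

/-! ### The uniform measure and rotations -/

/-- The space `ℝ^(d+1)` around the sphere `𝕊^d`. -/
abbrev Amb (d : ℕ) : Type := EuclideanSpace ℝ (Fin (d + 1))

instance (d : ℕ) : (unif d).IsOpenPosMeasure := by
  unfold unif
  exact Measure.isOpenPosMeasure_smul _ (ENNReal.inv_ne_zero.2 (measure_ne_top _ _))

theorem inner_toL2 {d : ℕ} (f g : C(Sph d, ℝ)) :
    ⟪toL2 f, toL2 g⟫_ℝ = ∫ x, f x * g x ∂(unif d) := by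
  rw [ContinuousMap.inner_toLp]
  simp [mul_comm]

theorem toL2_zero (d : ℕ) : toL2 (0 : C(Sph d, ℝ)) = 0 := map_zero (ContinuousMap.toLp 2 (unif d) ℝ)

theorem toL2_add {d : ℕ} (f g : C(Sph d, ℝ)) : toL2 (f + g) = toL2 f + toL2 g :=
  map_add (ContinuousMap.toLp 2 (unif d) ℝ) f g

theorem toL2_smul {d : ℕ} (c : ℝ) (f : C(Sph d, ℝ)) : toL2 (c • f) = c • toL2 f :=
  map_smul (ContinuousMap.toLp 2 (unif d) ℝ) c f

theorem toL2_sum {d : ℕ} {ι : Type*} (s : Finset ι) (f : ι → C(Sph d, ℝ)) :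
    toL2 (∑ i ∈ s, f i) = ∑ i ∈ s, toL2 (f i) :=
  map_sum (ContinuousMap.toLp 2 (unif d) ℝ) f s

theorem toL2_injective (d : ℕ) : Function.Injective (toL2 : C(Sph d, ℝ) → L2 d) :=
  ContinuousMap.toLp_injective (unif d)

theorem integrable_continuousMap {d : ℕ} (f : C(Sph d, ℝ)) : Integrable f (unif d) :=
  f.continuous.integrable_of_hasCompactSupport (HasCompactSupport.of_compactSpace _)

theorem integrable_mul {d : ℕ} (f g : C(Sph d, ℝ)) : Integrable (fun x => f x * g x) (unif d) :=
  integrable_continuousMap (f * g)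

theorem eq_zero_of_integral_mul_self {d : ℕ} {f : C(Sph d, ℝ)}
    (h : ∫ x, f x * f x ∂(unif d) = 0) : f = 0 := by
  rw [← inner_toL2, inner_self_eq_zero] at h
  exact toL2_injective d (h.trans (toL2_zero d).symm)

/-- The action of a linear isometry of `ℝ^(d+1)` on the sphere. -/
def rot {d : ℕ} (R : Amb d ≃ₗᵢ[ℝ] Amb d) : Sph d ≃ₜ Sph d where
  toFun x := ⟨R x, by simp⟩
  invFun x := ⟨R.symm x, by simp⟩
  left_inv x := by simp
  right_inv x := by simp

@[simp]
theorem coe_rot {d : ℕ} (R : Amb d ≃ₗᵢ[ℝ] Amb d) (x : Sph d) : (rot R x : Amb d) = R x := rfl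

/-- `rot R` as a continuous map. -/
def rotMap {d : ℕ} (R : Amb d ≃ₗᵢ[ℝ] Amb d) : C(Sph d, Sph d) := ⟨rot R, (rot R).continuous⟩

@[simp]
theorem rotMap_apply {d : ℕ} (R : Amb d ≃ₗᵢ[ℝ] Amb d) (x : Sph d) : rotMap R x = rot R x := rfl

theorem rot_symm_rot {d : ℕ} (R : Amb d ≃ₗᵢ[ℝ] Amb d) (x : Sph d) :
    rot R.symm (rot R x) = x := by
  ext1
  simp

theorem measurePreserving_rot {d : ℕ} (R : Amb d ≃ₗᵢ[ℝ] Amb d) :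
    MeasurePreserving (rot R) (unif d) (unif d) := by
  refine ⟨(rot R).continuous.measurable, ?_⟩
  unfold unif
  rw [Measure.map_smul]
  congr 1
  ext s hs
  rw [Measure.map_apply (rot R).continuous.measurable hs, Measure.toSphere_apply' _ hs,
    Measure.toSphere_apply' _ ((rot R).continuous.measurable hs)]
  congr 1
  refine Eq.trans ?_ (R.measurePreserving.measure_preimage_emb
    R.toHomeomorph.measurableEmbedding _)
  congr 1
  ext x
  simp only [Set.mem_smul, Set.mem_image, Set.mem_preimage]
  constructor
  · rintro ⟨r, hr, _, ⟨y, hy, rfl⟩, rfl⟩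
    exact ⟨r, hr, _, ⟨_, hy, rfl⟩, by simp⟩
  · rintro ⟨r, hr, _, ⟨y, hy, rfl⟩, h⟩
    refine ⟨r, hr, _, ⟨(rot R).symm y, by simpa using hy, rfl⟩, ?_⟩
    apply R.injective
    have : R ((rot R).symm y : Amb d) = y := R.apply_symm_apply _
    rw [map_smul, this, h]

theorem integral_comp_rot {d : ℕ} (R : Amb d ≃ₗᵢ[ℝ] Amb d) (f : Sph d → ℝ) :
    ∫ x, f (rot R x) ∂(unif d) = ∫ x, f x ∂(unif d) :=
  (measurePreserving_rot R).integral_comp (rot R).measurableEmbedding f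

/-- Two pairs of points with the same inner product lie in the same orbit of the isometry group:
compose a reflection that moves the first points onto each other with one that fixes them. -/
theorem exists_rot_eq {d : ℕ} {x y x' y' : Sph d}
    (h : ⟪(x : Amb d), y⟫_ℝ = ⟪(x' : Amb d), y'⟫_ℝ) :
    ∃ R : Amb d ≃ₗᵢ[ℝ] Amb d, rot R x = x' ∧ rot R y = y' := by
  have hn : ∀ z : Sph d, ‖(z : Amb d)‖ = 1 := fun z => by simp
  let S := (ℝ ∙ ((x : Amb d) - x'))ᗮ.reflection
  have hS : S x = x' := Submodule.reflection_sub (by rw [hn, hn])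
  let Q := (ℝ ∙ (S y - (y' : Amb d)))ᗮ.reflection
  have hQ : Q (S y) = y' := Submodule.reflection_sub (by rw [S.norm_map, hn, hn])
  have hQ' : Q x' = x' := by
    refine Submodule.reflection_mem_subspace_eq_self ?_
    rw [Submodule.mem_orthogonal_singleton_iff_inner_right, inner_sub_left]
    rw [← hS, S.inner_map_map, real_inner_comm, h, hS, real_inner_comm, sub_self]
  refine ⟨S.trans Q, ?_, ?_⟩
  · ext1
    simp [hS, hQ']
  · ext1
    simp [hQ]

/-! ### Integration by parts on the sphere -/

open MvPolynomial in
theorem hasDerivAt_eval_comp {σ : Type*} [Fintype σ] (p : MvPolynomial σ ℝ) {c : ℝ → σ → ℝ}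
    {c' : σ → ℝ} {t : ℝ} (hc : ∀ k, HasDerivAt (fun s => c s k) (c' k) t) :
    HasDerivAt (fun s => eval (c s) p) (∑ k, c' k * eval (c t) (pderiv k p)) t := by
  classical
  induction p using MvPolynomial.induction_on with
  | C a => simpa using hasDerivAt_const t a
  | add p q hp hq =>
    simp only [map_add, mul_add, Finset.sum_add_distrib]
    exact hp.add hq
  | mul_X p i hp =>
    simp only [map_mul, eval_X, Derivation.leibniz, smul_eq_mul, map_add, mul_add,
      Finset.sum_add_distrib]
    convert! hp.mul (hc i) using 1
    rw [add_comm]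
    congr 1
    · rw [Finset.sum_mul]
      exact Finset.sum_congr rfl fun k _ => by ring
    · rw [Finset.sum_eq_single i]
      · simp [mul_comm]
      · intro b _ hb
        simp [pderiv_X_of_ne hb.symm]
      · simp

/-- The rotation by the angle `θ` in the plane of the coordinates `i ≠ j`. -/
def planeRotLin {d : ℕ} (i j : Fin (d + 1)) (θ : ℝ) : Amb d →ₗ[ℝ] Amb d where
  toFun x := x + ((Real.cos θ - 1) * x i - Real.sin θ * x j) • EuclideanSpace.single i (1 : ℝ)
    + ((Real.cos θ - 1) * x j + Real.sin θ * x i) • EuclideanSpace.single j (1 : ℝ)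
  map_add' x y := by
    ext k
    simp only [PiLp.add_apply, PiLp.smul_apply, smul_eq_mul]
    ring
  map_smul' a x := by
    ext k
    simp only [PiLp.add_apply, PiLp.smul_apply, smul_eq_mul, RingHom.id_apply]
    ring

theorem planeRotLin_apply {d : ℕ} (i j : Fin (d + 1)) (θ : ℝ) (x : Amb d) (k : Fin (d + 1)) :
    planeRotLin i j θ x k = x k +
      ((Real.cos θ - 1) * x i - Real.sin θ * x j) * (if k = i then 1 else 0) +
      ((Real.cos θ - 1) * x j + Real.sin θ * x i) * (if k = j then 1 else 0) := by
  simp [planeRotLin, PiLp.single_apply]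

theorem norm_planeRotLin {d : ℕ} {i j : Fin (d + 1)} (hij : i ≠ j) (θ : ℝ) (x : Amb d) :
    ‖planeRotLin i j θ x‖ = ‖x‖ := by
  rw [← sq_eq_sq₀ (norm_nonneg _) (norm_nonneg _), EuclideanSpace.real_norm_sq_eq,
    EuclideanSpace.real_norm_sq_eq, ← sub_eq_zero, ← Finset.sum_sub_distrib,
    Finset.sum_eq_add i j hij]
  · simp only [planeRotLin_apply, if_neg hij, if_neg hij.symm, if_true]
    linear_combination (x i ^ 2 + x j ^ 2) * Real.sin_sq_add_cos_sq θ
  · intro k _ hk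
    simp [planeRotLin_apply, hk.1, hk.2]
  · simp
  · simp

/-- `planeRotLin` as a linear isometry. -/
def planeRot {d : ℕ} {i j : Fin (d + 1)} (hij : i ≠ j) (θ : ℝ) : Amb d ≃ₗᵢ[ℝ] Amb d :=
  LinearIsometry.toLinearIsometryEquiv ⟨planeRotLin i j θ, norm_planeRotLin hij θ⟩ rfl

theorem planeRot_apply {d : ℕ} {i j : Fin (d + 1)} (hij : i ≠ j) (θ : ℝ) (x : Amb d)
    (k : Fin (d + 1)) : planeRot hij θ x k = x k +
      ((Real.cos θ - 1) * x i - Real.sin θ * x j) * (if k = i then 1 else 0) +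
      ((Real.cos θ - 1) * x j + Real.sin θ * x i) * (if k = j then 1 else 0) :=
  planeRotLin_apply i j θ x k

/-- The mean of a polynomial over the sphere. -/
def mean (d : ℕ) : MvPolynomial (Fin (d + 1)) ℝ →ₗ[ℝ] ℝ where
  toFun p := ∫ x, restrict d p x ∂(unif d)
  map_add' p q := by
    simp only [map_add, ContinuousMap.add_apply]
    exact integral_add (integrable_continuousMap _) (integrable_continuousMap _)
  map_smul' c p := by
    simp only [map_smul, ContinuousMap.smul_apply, RingHom.id_apply]
    exact integral_smul c _

theorem mean_apply {d : ℕ} (p : MvPolynomial (Fin (d + 1)) ℝ) :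
    mean d p = ∫ x, restrict d p x ∂(unif d) := rfl

theorem restrict_apply {d : ℕ} (p : MvPolynomial (Fin (d + 1)) ℝ) (x : Sph d) :
    restrict d p x = MvPolynomial.eval (fun i => (x : Amb d) i) p := rfl

theorem restrict_mul {d : ℕ} (p q : MvPolynomial (Fin (d + 1)) ℝ) :
    restrict d (p * q) = restrict d p * restrict d q := by
  ext x
  simp [restrict_apply]

theorem mean_mul {d : ℕ} (p q : MvPolynomial (Fin (d + 1)) ℝ) :
    mean d (p * q) = ∫ x, restrict d p x * restrict d q x ∂(unif d) := by
  simp [mean_apply, restrict_mul]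

open MvPolynomial in
/-- The derivative along the rotations in the `(i, j)`-plane is `x_i ∂_j - x_j ∂_i`. -/
theorem hasDerivAt_restrict_planeRot {d : ℕ} {i j : Fin (d + 1)} (hij : i ≠ j)
    (p : MvPolynomial (Fin (d + 1)) ℝ) (x : Sph d) (θ : ℝ) :
    HasDerivAt (fun θ => restrict d p (rot (planeRot hij θ) x))
      (restrict d (X i * pderiv j p - X j * pderiv i p) (rot (planeRot hij θ) x)) θ := by
  have h := hasDerivAt_eval_comp p (c := fun θ k => planeRot hij θ x k) (t := θ)
    (c' := fun k => (if k = j then planeRot hij θ x i else 0) -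
      (if k = i then planeRot hij θ x j else 0)) ?_
  · refine h.congr_deriv ?_
    simp only [sub_mul, Finset.sum_sub_distrib, ite_mul, zero_mul, Finset.sum_ite_eq',
      Finset.mem_univ, if_true]
    simp [restrict_apply]
  · intro k
    simp only [planeRot_apply]
    have h1 := (((Real.hasDerivAt_cos θ).sub_const 1).mul_const ((x : Amb d) i)).sub
      ((Real.hasDerivAt_sin θ).mul_const ((x : Amb d) j))
    have h2 := (((Real.hasDerivAt_cos θ).sub_const 1).mul_const ((x : Amb d) j)).add
      ((Real.hasDerivAt_sin θ).mul_const ((x : Amb d) i))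
    refine (((h1.mul_const (if k = i then (1 : ℝ) else 0)).const_add ((x : Amb d) k)).add
      (h2.mul_const (if k = j then (1 : ℝ) else 0))).congr_deriv ?_
    simp only [if_neg hij, if_neg hij.symm, if_true]
    split_ifs <;> ring

open MvPolynomial in
/-- The infinitesimal generator of a rotation has mean zero, since the mean is invariant under the
rotation. -/
theorem mean_rotGen {d : ℕ} {i j : Fin (d + 1)} (p : MvPolynomial (Fin (d + 1)) ℝ) :
    mean d (X i * pderiv j p) = mean d (X j * pderiv i p) := by
  rcases eq_or_ne i j with rfl | hij
  · rfl
  rw [← sub_eq_zero, ← map_sub]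
  have hder := hasDerivAt_restrict_planeRot hij p
  generalize X i * pderiv j p - X j * pderiv i p = q at hder ⊢
  generalize restrict d p = f at hder
  rw [mean_apply]
  generalize restrict d q = g at hder ⊢
  have key := hasDerivAt_integral_of_dominated_loc_of_deriv_le (μ := unif d) (x₀ := (0 : ℝ))
    (F := fun θ x => f (rot (planeRot hij θ) x))
    (F' := fun θ x => g (rot (planeRot hij θ) x))
    (s := Set.univ) (bound := fun _ => ‖g‖) univ_mem
    (Eventually.of_forall fun θ => (f.continuous.comp
      (rot _).continuous).aestronglyMeasurable)
    (integrable_continuousMap (f.comp (rotMap _)))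
    (g.continuous.comp (rot _).continuous).aestronglyMeasurable
    (Eventually.of_forall fun x θ _ => ContinuousMap.norm_coe_le_norm _ _)
    (integrable_const _) (Eventually.of_forall fun x θ _ => hder x θ)
  have h2 := key.2
  simp only [integral_comp_rot] at h2
  exact h2.unique (hasDerivAt_const _ _)

section

open MvPolynomial

/-- The Laplacian on polynomials in `d + 1` variables. -/
def lap (d : ℕ) : MvPolynomial (Fin (d + 1)) ℝ →ₗ[ℝ] MvPolynomial (Fin (d + 1)) ℝ :=
  ∑ i : Fin (d + 1),
      (MvPolynomial.pderiv (R := ℝ) i).toLinearMap ∘ₗ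
        (MvPolynomial.pderiv (R := ℝ) i).toLinearMap

theorem lap_apply {d : ℕ} (p : MvPolynomial (Fin (d + 1)) ℝ) :
    lap d p = ∑ i, pderiv i (pderiv i p) := by
  simp [lap, LinearMap.sum_apply]

theorem mem_harmonicPoly {d n : ℕ} {p : MvPolynomial (Fin (d + 1)) ℝ} :
    p ∈ harmonicPoly d n ↔ p.IsHomogeneous n ∧ lap d p = 0 := by
  rw [harmonicPoly, Submodule.mem_inf, mem_homogeneousSubmodule]
  rfl

/-- The polynomial `|x|²`. -/
def normSqPoly (d : ℕ) : MvPolynomial (Fin (d + 1)) ℝ := ∑ i, X i * X i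

theorem restrict_normSqPoly (d : ℕ) : restrict d (normSqPoly d) = 1 := by
  ext x
  have h : ‖(x : Amb d)‖ ^ 2 = 1 := by simp
  rw [EuclideanSpace.real_norm_sq_eq] at h
  simpa [restrict_apply, normSqPoly, sq] using h

theorem isHomogeneous_normSqPoly (d : ℕ) : (normSqPoly d).IsHomogeneous 2 :=
  IsHomogeneous.sum _ _ _ fun i _ => (isHomogeneous_X ℝ i).mul (isHomogeneous_X ℝ i)

theorem mean_normSqPoly_mul {d : ℕ} (p : MvPolynomial (Fin (d + 1)) ℝ) :
    mean d (normSqPoly d * p) = mean d p := by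
  simp [mean_apply, restrict_mul, restrict_normSqPoly]

/-- The sum over `i, j` of the identity `mean_rotGen` for the polynomials `x_i ∂_j p`, evaluated by
Euler's relation. -/
theorem mean_lap {d k : ℕ} {p : MvPolynomial (Fin (d + 1)) ℝ} (hp : p.IsHomogeneous k) :
    mean d (lap d p) = k * (k + d - 1) * mean d p := by
  have hE : ∑ j, X j * pderiv j p = (k : ℝ) • p := by
    rw [hp.sum_X_mul_pderiv, Nat.cast_smul_eq_nsmul]
  have hE2 : ∀ j, ∑ i, X i * pderiv i (pderiv j p) = ((k - 1 : ℕ) : ℝ) • pderiv j p := fun j => by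
    rw [(hp.pderiv (i := j)).sum_X_mul_pderiv, Nat.cast_smul_eq_nsmul]
  have hL : ∑ i, ∑ j, X i * pderiv j (X i * pderiv j p) =
      (k : ℝ) • p + normSqPoly d * lap d p := by
    rw [← hE, normSqPoly, lap_apply, Finset.sum_mul_sum, ← Finset.sum_add_distrib]
    refine Finset.sum_congr rfl fun i _ => ?_
    have : ∀ j, X i * pderiv j (X i * pderiv j p) =
        (if j = i then X i * pderiv i p else 0) + X i * X i * pderiv j (pderiv j p) := by
      intro j
      rw [Derivation.leibniz, pderiv_X]
      split_ifs with h
      · subst h; simp [mul_add]; ring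
      · simp [h]; ring
    rw [Finset.sum_congr rfl fun j _ => this j]
    simp [Finset.sum_add_distrib]
  have hR : ∑ i, ∑ j, X j * pderiv i (X i * pderiv j p) =
      ((d + 1 : ℝ) * k + ((k - 1 : ℕ) : ℝ) * k) • p := by
    rw [Finset.sum_comm]
    have : ∀ j, ∑ i, X j * pderiv i (X i * pderiv j p) =
        ((d + 1 : ℝ) + ((k - 1 : ℕ) : ℝ)) • (X j * pderiv j p) := by
      intro j
      have h1 : ∀ i, X j * pderiv i (X i * pderiv j p) =
          X j * pderiv j p + X j * (X i * pderiv i (pderiv j p)) := by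
        intro i
        rw [Derivation.leibniz, pderiv_X_self]
        simp only [smul_eq_mul]
        ring
      simp only [h1, Finset.sum_add_distrib, ← Finset.mul_sum, hE2]
      rw [Finset.sum_const, Finset.card_univ, Fintype.card_fin, ← Nat.cast_smul_eq_nsmul ℝ,
        Nat.cast_add_one, mul_smul_comm, mul_smul_comm, ← add_smul]
    rw [Finset.sum_congr rfl fun j _ => this j, ← Finset.smul_sum, hE, smul_smul, ← add_mul]
  have h : mean d (∑ i, ∑ j, X i * pderiv j (X i * pderiv j p)) =
      mean d (∑ i, ∑ j, X j * pderiv i (X i * pderiv j p)) := by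
    simp only [map_sum]
    exact Finset.sum_congr rfl fun i _ => Finset.sum_congr rfl fun j _ => mean_rotGen _
  rw [hL, hR, map_add, map_smul, map_smul, mean_normSqPoly_mul] at h
  simp only [smul_eq_mul] at h
  rcases k with _ | k
  · simp at h ⊢; linarith
  · simp only [Nat.add_sub_cancel] at h
    push_cast at h ⊢
    linarith

theorem pderiv_mem_harmonicPoly {d n : ℕ} {p : MvPolynomial (Fin (d + 1)) ℝ}
    (hp : p ∈ harmonicPoly d n) (i : Fin (d + 1)) : pderiv i p ∈ harmonicPoly d (n - 1) := by
  rw [mem_harmonicPoly] at hp ⊢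
  refine ⟨hp.1.pderiv, ?_⟩
  have h := congrArg (pderiv i) hp.2
  rw [lap_apply, map_sum, map_zero] at h
  rw [lap_apply, ← h]
  refine Finset.sum_congr rfl fun j _ => ?_
  have hc : ∀ q : MvPolynomial (Fin (d + 1)) ℝ, pderiv i (pderiv j q) = pderiv j (pderiv i q) :=
    fun q => by
      -- a derivation that vanishes on the variables is zero
      have h0 : ⁅(pderiv i : Derivation ℝ (MvPolynomial (Fin (d + 1)) ℝ) _),
          (pderiv j : Derivation ℝ (MvPolynomial (Fin (d + 1)) ℝ) _)⁆ = 0 := by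
        ext k
        simp [Derivation.commutator_apply, pderiv_X, Pi.single_apply, apply_ite]
      simpa [Derivation.commutator_apply, sub_eq_zero] using DFunLike.congr_fun h0 q
  rw [hc, hc]

theorem lap_mul {d : ℕ} (p q : MvPolynomial (Fin (d + 1)) ℝ) :
    lap d (p * q) = lap d p * q + p * lap d q + 2 * ∑ i, pderiv i p * pderiv i q := by
  simp only [lap_apply, Derivation.leibniz, smul_eq_mul, map_add, Finset.sum_mul, Finset.mul_sum,
    ← Finset.sum_add_distrib]
  exact Finset.sum_congr rfl fun i _ => by ring

theorem pderiv_eq_zero_of_isHomogeneous_zero {σ : Type*} {p : MvPolynomial σ ℝ}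
    (hp : p.IsHomogeneous 0) (i : σ) : pderiv i p = 0 := by
  rw [totalDegree_eq_zero_iff_eq_C.1 ((totalDegree_zero_iff_isHomogeneous _).2 hp), pderiv_C]

theorem mean_mul_of_mem_harmonicPoly {d n m : ℕ} {p q : MvPolynomial (Fin (d + 1)) ℝ}
    (hp : p ∈ harmonicPoly d n) (hq : q ∈ harmonicPoly d m) :
    ((n + m : ℕ) : ℝ) * ((n + m : ℕ) + d - 1) * mean d (p * q) =
      2 * ∑ i, mean d (pderiv i p * pderiv i q) := by
  rw [mem_harmonicPoly] at hp hq
  rw [← mean_lap (hp.1.mul hq.1), lap_mul, hp.2, hq.2, zero_mul, mul_zero, zero_add, zero_add,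
    two_mul, map_add, map_sum, two_mul]

/-- Harmonic polynomials of different degrees are orthogonal on the sphere: by `mean_lap`,
`∫ p q` is a multiple of `∫ Δ(p q) = 2 ∑ i, ∫ ∂_i p ∂_i q`, and the degrees go down. -/
theorem mean_mul_eq_zero {d : ℕ} (hd : 1 ≤ d) {n m : ℕ} (hnm : n ≠ m)
    {p q : MvPolynomial (Fin (d + 1)) ℝ} (hp : p ∈ harmonicPoly d n) (hq : q ∈ harmonicPoly d m) :
    mean d (p * q) = 0 := by
  induction n generalizing m p q with
  | zero =>
    have h := mean_mul_of_mem_harmonicPoly hp hq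
    simp only [pderiv_eq_zero_of_isHomogeneous_zero (mem_harmonicPoly.1 hp).1, zero_mul, map_zero,
      Finset.sum_const_zero, mul_zero] at h
    refine (mul_eq_zero.1 h).resolve_left (mul_ne_zero ?_ ?_)
    · exact Nat.cast_ne_zero.2 (by omega)
    · have h1 : (1 : ℝ) ≤ (0 + m : ℕ) := Nat.one_le_cast.2 (by omega)
      have h2 : (1 : ℝ) ≤ d := Nat.one_le_cast.2 hd
      linarith
  | succ n ih =>
    have h := mean_mul_of_mem_harmonicPoly hp hq
    have h0 : ∀ i, mean d (pderiv i p * pderiv i q) = 0 := by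
      intro i
      rcases m with _ | m
      · rw [pderiv_eq_zero_of_isHomogeneous_zero (mem_harmonicPoly.1 hq).1, mul_zero, map_zero]
      · exact ih (by omega) (pderiv_mem_harmonicPoly hp i) (pderiv_mem_harmonicPoly hq i)
    simp only [h0, Finset.sum_const_zero, mul_zero] at h
    refine (mul_eq_zero.1 h).resolve_left (mul_ne_zero ?_ ?_)
    · exact Nat.cast_ne_zero.2 (by omega)
    · have h1 : (1 : ℝ) ≤ (n + 1 + m : ℕ) := Nat.one_le_cast.2 (by omega)
      have h2 : (1 : ℝ) ≤ d := Nat.one_le_cast.2 hd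
      linarith

theorem harmonics_orthogonal {d : ℕ} (hd : 1 ≤ d) {n m : ℕ} (hnm : n ≠ m) {f g : C(Sph d, ℝ)}
    (hf : f ∈ harmonics d n) (hg : g ∈ harmonics d m) : ∫ x, f x * g x ∂(unif d) = 0 := by
  obtain ⟨p, hp, rfl⟩ := hf
  obtain ⟨q, hq, rfl⟩ := hg
  rw [← mean_mul]
  exact mean_mul_eq_zero hd hnm hp hq

/-! ### Decomposition of polynomials into spherical harmonics -/

theorem eval_smul_of_isHomogeneous {σ : Type*} {n : ℕ} {p : MvPolynomial σ ℝ}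
    (hp : p.IsHomogeneous n) (r : ℝ) (x : σ → ℝ) : eval (r • x) p = r ^ n * eval x p := by
  rw [eval_eq, eval_eq, Finset.mul_sum]
  refine Finset.sum_congr rfl fun m hm => ?_
  simp only [Pi.smul_apply, smul_eq_mul, mul_pow, Finset.prod_mul_distrib]
  rw [Finset.prod_pow_eq_pow_sum, ← hp.degree_eq_sum_deg_support hm]
  ring

/-- A homogeneous polynomial is determined by its restriction to the sphere. -/
theorem eq_zero_of_restrict_eq_zero {d n : ℕ} {p : MvPolynomial (Fin (d + 1)) ℝ}
    (hp : p.IsHomogeneous n) (h : restrict d p = 0) : p = 0 := by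
  refine hp.eq_zero_of_forall_eval_eq_zero fun x => ?_
  obtain ⟨r, s, hs⟩ : ∃ (r : ℝ) (s : Sph d), WithLp.toLp 2 x = r • (s : Amb d) := by
    by_cases hx : WithLp.toLp 2 x = 0
    · exact ⟨0, ⟨EuclideanSpace.single 0 1, by simp⟩, by simpa using hx⟩
    · have hx' : ‖WithLp.toLp 2 x‖ ≠ 0 := norm_ne_zero_iff.2 hx
      exact ⟨‖WithLp.toLp 2 x‖, ⟨‖WithLp.toLp 2 x‖⁻¹ • WithLp.toLp 2 x, by
        simp [norm_smul, hx']⟩, by simp [smul_smul, hx']⟩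
  have hx : x = r • fun i => (s : Amb d) i := by
    ext i
    exact congrArg (fun y : Amb d => y i) hs
  rw [hx, eval_smul_of_isHomogeneous hp, ← restrict_apply, h]
  simp

/-- The span of the spherical harmonics of degree less than `n`. -/
def harmonicsLT (d n : ℕ) : Submodule ℝ C(Sph d, ℝ) := ⨆ j, ⨆ _ : j < n, harmonics d j

theorem harmonics_le_harmonicsLT {d j n : ℕ} (h : j < n) : harmonics d j ≤ harmonicsLT d n :=
  le_iSup₂_of_le j h le_rfl

theorem harmonicsLT_mono (d : ℕ) : Monotone (harmonicsLT d) := fun _ _ h =>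
  iSup₂_le fun _ hj => harmonics_le_harmonicsLT (hj.trans_le h)

theorem harmonicsLT_succ (d n : ℕ) : harmonicsLT d (n + 1) = harmonicsLT d n ⊔ harmonics d n := by
  refine le_antisymm (iSup₂_le fun j hj => ?_)
    (sup_le (harmonicsLT_mono d n.le_succ) (harmonics_le_harmonicsLT n.lt_succ_self))
  rcases (Nat.lt_succ_iff.1 hj).lt_or_eq with h | rfl
  · exact le_sup_of_le_left (harmonics_le_harmonicsLT h)
  · exact le_sup_right

theorem harmonicsLT_orthogonal {d : ℕ} (hd : 1 ≤ d) {n m : ℕ} (hnm : n ≤ m) {f g : C(Sph d, ℝ)}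
    (hf : f ∈ harmonicsLT d n) (hg : g ∈ harmonics d m) : ∫ x, f x * g x ∂(unif d) = 0 := by
  have h : harmonicsLT d n ≤ LinearMap.ker ((innerₛₗ ℝ (toL2 g)) ∘ₗ
      (ContinuousMap.toLp 2 (unif d) ℝ : C(Sph d, ℝ) →L[ℝ] L2 d).toLinearMap) := by
    refine iSup₂_le fun j hj f hf => ?_
    change ⟪toL2 g, toL2 f⟫_ℝ = 0
    rw [inner_toL2]
    exact harmonics_orthogonal hd (by omega) hg hf
  have h2 : ⟪toL2 g, toL2 f⟫_ℝ = 0 := h hf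
  rwa [real_inner_comm, inner_toL2] at h2

instance finiteDimensional_homogeneousSubmodule {σ : Type*} [Finite σ] (n : ℕ) :
    FiniteDimensional ℝ (homogeneousSubmodule σ ℝ n) :=
  Module.Finite.iff_fg.2 (homogeneousSubmodule_fg σ ℝ n)

theorem isHomogeneous_lap {d n : ℕ} {p : MvPolynomial (Fin (d + 1)) ℝ}
    (hp : p.IsHomogeneous n) : (lap d p).IsHomogeneous (n - 2) := by
  rw [lap_apply]
  exact IsHomogeneous.sum _ _ _ fun i _ => hp.pderiv.pderiv

/-- If `|x|² q` is harmonic, then `q`, as a sum of spherical harmonics of lower degrees on the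
sphere, is orthogonal to itself. -/
theorem eq_zero_of_lap_normSqPoly_mul {d n : ℕ} (hd : 1 ≤ d) {q : MvPolynomial (Fin (d + 1)) ℝ}
    (hq : q.IsHomogeneous n) (hW : restrict d q ∈ harmonicsLT d (n + 1))
    (h : lap d (normSqPoly d * q) = 0) : q = 0 := by
  refine eq_zero_of_restrict_eq_zero hq (eq_zero_of_integral_mul_self ?_)
  refine harmonicsLT_orthogonal hd (n + 1).le_succ hW ?_
  refine ⟨normSqPoly d * q, mem_harmonicPoly.2 ⟨?_, h⟩, ?_⟩
  · rw [show (n + 1).succ = 2 + n by omega]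
    exact (isHomogeneous_normSqPoly d).mul hq
  · rw [restrict_mul, restrict_normSqPoly, one_mul]

/-- The map `q ↦ Δ(|x|² q)` is injective on homogeneous polynomials of degree `n`, hence onto. -/
theorem exists_lap_normSqPoly_mul_eq {d n : ℕ} (hd : 1 ≤ d)
    (hW : ∀ q : MvPolynomial (Fin (d + 1)) ℝ, q.IsHomogeneous n →
      restrict d q ∈ harmonicsLT d (n + 1))
    {p : MvPolynomial (Fin (d + 1)) ℝ} (hp : p.IsHomogeneous n) :
    ∃ q : MvPolynomial (Fin (d + 1)) ℝ, q.IsHomogeneous n ∧ lap d (normSqPoly d * q) = p := by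
  have hmem : ∀ q ∈ homogeneousSubmodule (Fin (d + 1)) ℝ n,
      (lap d ∘ₗ LinearMap.mulLeft ℝ (normSqPoly d)) q ∈ homogeneousSubmodule (Fin (d + 1)) ℝ n := by
    intro q hq
    have := isHomogeneous_lap ((isHomogeneous_normSqPoly d).mul hq)
    rwa [Nat.add_sub_cancel_left] at this
  let A := LinearMap.restrict _ hmem
  have hA : Function.Surjective A := by
    rw [← LinearMap.injective_iff_surjective, injective_iff_map_eq_zero]
    intro q hq
    exact Subtype.ext (eq_zero_of_lap_normSqPoly_mul hd q.2 (hW q q.2) (congrArg Subtype.val hq))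
  obtain ⟨q, hq⟩ := hA ⟨p, hp⟩
  exact ⟨q, q.2, congrArg Subtype.val hq⟩

/-- On the sphere, a homogeneous polynomial is a sum of spherical harmonics: with `Δ(|x|² r) = Δq`,
the polynomial `q - |x|² r` is harmonic, and `|x|² r` agrees with `r`, which has lower degree. -/
theorem restrict_mem_harmonicsLT {d : ℕ} (hd : 1 ≤ d) (n : ℕ) :
    ∀ q : MvPolynomial (Fin (d + 1)) ℝ, q.IsHomogeneous n →
      restrict d q ∈ harmonicsLT d (n + 1) := by
  induction n using Nat.strong_induction_on with
  | _ n ih =>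
    intro q hq
    rcases lt_or_ge n 2 with hn | hn
    · refine harmonics_le_harmonicsLT n.lt_succ_self ⟨q, mem_harmonicPoly.2 ⟨hq, ?_⟩, rfl⟩
      rw [lap_apply]
      refine Finset.sum_eq_zero fun i _ => pderiv_eq_zero_of_isHomogeneous_zero ?_ i
      have := hq.pderiv (i := i)
      rwa [show n - 1 = 0 by omega] at this
    · obtain ⟨m, rfl⟩ := Nat.exists_eq_add_of_le' hn
      obtain ⟨r, hr, hrq⟩ := exists_lap_normSqPoly_mul_eq hd (ih m (by omega))
        (isHomogeneous_lap hq)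
      have h1 : q - normSqPoly d * r ∈ harmonicPoly d (m + 2) := by
        refine mem_harmonicPoly.2 ⟨hq.sub ?_, by rw [map_sub, hrq, sub_self]⟩
        simpa only [add_comm m 2] using (isHomogeneous_normSqPoly d).mul hr
      have h2 : restrict d q = restrict d (q - normSqPoly d * r) + restrict d r := by
        rw [map_sub, restrict_mul, restrict_normSqPoly, one_mul, sub_add_cancel]
      rw [h2]
      exact add_mem (harmonics_le_harmonicsLT (Nat.lt_succ_self _) ⟨_, h1, rfl⟩)
        (harmonicsLT_mono d (by omega) (ih m (by omega) r hr))

theorem restrict_mem_harmonicsLT_of_totalDegree {d : ℕ} (hd : 1 ≤ d) {n : ℕ}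
    {q : MvPolynomial (Fin (d + 1)) ℝ} (hq : q.totalDegree < n) :
    restrict d q ∈ harmonicsLT d n := by
  rw [← sum_homogeneousComponent q, map_sum]
  refine sum_mem fun j hj => harmonicsLT_mono d ?_ (restrict_mem_harmonicsLT hd j _
    (homogeneousComponent_isHomogeneous j q))
  have := Finset.mem_range.1 hj
  omega

/-! ### The dimension of the spaces of spherical harmonics -/

theorem finrank_homogeneousSubmodule (d n : ℕ) :
    Module.finrank ℝ (homogeneousSubmodule (Fin (d + 1)) ℝ n) = (n + d).choose n := by
  have hs : {m : Fin (d + 1) →₀ ℕ | m.degree = n} =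
      (Finset.finsuppAntidiag (Finset.univ : Finset (Fin (d + 1))) n : Set _) := by
    ext m
    simp [Finset.mem_finsuppAntidiag, Finsupp.degree_eq_sum]
  rw [homogeneousSubmodule_eq_finsupp_supported, hs,
    (AddMonoidAlgebra.supportedEquivFinsupp _).finrank_eq, Module.finrank_finsupp_self]
  simp only [Finset.coe_sort_coe, Fintype.card_coe, Finset.card_finsuppAntidiag_nat_eq_choose,
    Finset.card_univ, Fintype.card_fin]
  congr 1
  omega

/-- For `n ≥ 2`, the Laplacian maps the homogeneous polynomials of degree `n` onto those of degree
`n - 2`; its kernel is the space of harmonic polynomials. -/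
theorem finrank_harmonicPoly {d : ℕ} (hd : 1 ≤ d) (n : ℕ) :
    Module.finrank ℝ (harmonicPoly d n) = harmDim d n := by
  rcases lt_or_ge n 2 with hn | hn
  · have h : harmonicPoly d n = homogeneousSubmodule (Fin (d + 1)) ℝ n := by
      ext q
      rw [mem_harmonicPoly, mem_homogeneousSubmodule, and_iff_left_iff_imp]
      intro hq
      rw [lap_apply]
      refine Finset.sum_eq_zero fun i _ => pderiv_eq_zero_of_isHomogeneous_zero ?_ i
      have := hq.pderiv (i := i)
      rwa [show n - 1 = 0 by omega] at this
    rw [h, finrank_homogeneousSubmodule, harmDim, if_neg (by omega), Nat.sub_zero]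
  · obtain ⟨m, rfl⟩ := Nat.exists_eq_add_of_le' hn
    let A := (lap d).restrict (p := homogeneousSubmodule (Fin (d + 1)) ℝ (m + 2))
      (q := homogeneousSubmodule (Fin (d + 1)) ℝ m) fun q hq => isHomogeneous_lap hq
    have hA : LinearMap.range A = ⊤ := by
      rw [LinearMap.range_eq_top]
      rintro ⟨p, hp⟩
      obtain ⟨q, hq, h⟩ := exists_lap_normSqPoly_mul_eq hd (restrict_mem_harmonicsLT hd m) hp
      refine ⟨⟨normSqPoly d * q, ?_⟩, Subtype.ext h⟩
      have := (isHomogeneous_normSqPoly d).mul hq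
      rwa [Nat.add_comm 2 m] at this
    have hK : harmonicPoly d (m + 2) = (LinearMap.ker A).map (Submodule.subtype _) := by
      ext q
      rw [mem_harmonicPoly, Submodule.mem_map]
      constructor
      · rintro ⟨h1, h2⟩
        exact ⟨⟨q, h1⟩, Subtype.ext h2, rfl⟩
      · rintro ⟨q, hq, rfl⟩
        exact ⟨q.2, congrArg Subtype.val hq⟩
    have h := LinearMap.finrank_range_add_finrank_ker A
    rw [hA, finrank_top, finrank_homogeneousSubmodule, finrank_homogeneousSubmodule] at h
    rw [hK, Submodule.finrank_map_subtype_eq, harmDim, if_pos (by omega), ← h]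
    simp only [Nat.add_sub_cancel, show m + 2 + d - 2 = m + d by omega, Nat.add_sub_cancel_left]

theorem finrank_harmonics {d : ℕ} (hd : 1 ≤ d) (n : ℕ) :
    Module.finrank ℝ (harmonics d n) = harmDim d n := by
  rw [← finrank_harmonicPoly hd, harmonics, ← LinearMap.range_domRestrict]
  refine LinearMap.finrank_range_of_inj ((injective_iff_map_eq_zero _).2 fun p hp => ?_)
  exact Subtype.ext (eq_zero_of_restrict_eq_zero (mem_harmonicPoly.1 p.2).1 hp)

theorem harmDim_pos {d : ℕ} (hd : 1 ≤ d) (n : ℕ) : 0 < harmDim d n := by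
  rw [harmDim]
  split_ifs with hn
  · obtain ⟨m, rfl⟩ := Nat.exists_eq_add_of_le' hn
    obtain ⟨e, rfl⟩ := Nat.exists_eq_add_of_le' hd
    rw [show m + 2 + (e + 1) = m + e + 1 + 1 + 1 by ring,
      show m + e + 1 + 1 + 1 - 2 = m + e + 1 by omega, show m + 2 = m + 1 + 1 by rfl,
      show m + 1 + 1 - 2 = m by omega, Nat.choose_succ_succ', Nat.choose_succ_succ']
    have : 0 < (m + e + 2).choose (m + 1 + 1) := Nat.choose_pos (by omega)
    omega
  · exact Nat.choose_pos (by omega)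

instance finiteDimensional_harmonics {d : ℕ} (n : ℕ) : FiniteDimensional ℝ (harmonics d n) := by
  have : FiniteDimensional ℝ (harmonicPoly d n) :=
    Submodule.finiteDimensional_of_le (S₂ := homogeneousSubmodule (Fin (d + 1)) ℝ n) inf_le_left
  unfold harmonics
  infer_instance

end

section

open MvPolynomial

/-! ### Completeness of the spherical harmonics -/

/-- `restrict` as an algebra homomorphism. -/
def restrictAlg (d : ℕ) : MvPolynomial (Fin (d + 1)) ℝ →ₐ[ℝ] C(Sph d, ℝ) :=
  AlgHom.ofLinearMap (restrict d) (by ext x; simp [restrict_apply]) restrict_mul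

theorem iSup_harmonics_topologicalClosure {d : ℕ} (hd : 1 ≤ d) :
    (⨆ n, harmonics d n).topologicalClosure = ⊤ := by
  have h : ((restrictAlg d).range).topologicalClosure = ⊤ := by
    refine ContinuousMap.subalgebra_topologicalClosure_eq_top_of_separatesPoints _ ?_
    intro x y hxy
    obtain ⟨i, hi⟩ : ∃ i, (x : Amb d) i ≠ (y : Amb d) i := by
      by_contra! h
      exact hxy (Subtype.ext (PiLp.ext h))
    exact ⟨_, ⟨_, ⟨X i, rfl⟩, rfl⟩, by simpa [restrictAlg, restrict_apply] using hi⟩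
  have hle : ((restrictAlg d).range : Set C(Sph d, ℝ)) ⊆ (⨆ n, harmonics d n : Submodule ℝ _) := by
    rintro _ ⟨p, rfl⟩
    exact (iSup₂_le fun j _ => le_iSup (harmonics d) j :
      harmonicsLT d (p.totalDegree + 1) ≤ _)
      (restrict_mem_harmonicsLT_of_totalDegree hd (Nat.lt_succ_self _))
  rw [Submodule.eq_top_iff']
  intro f
  have hf : f ∈ ((restrictAlg d).range).topologicalClosure := by rw [h]; trivial
  exact closure_mono hle hf

theorem toL2_denseRange (d : ℕ) : DenseRange (toL2 : C(Sph d, ℝ) → L2 d) :=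
  ContinuousMap.toLp_denseRange ℝ (unif d) ℝ (by simp)

/-- An element of `L²(𝕊^d)` orthogonal to all spherical harmonics vanishes. -/
theorem eq_zero_of_inner_harmonics {d : ℕ} (hd : 1 ≤ d) {f : L2 d}
    (h : ∀ n, ∀ g ∈ harmonics d n, ⟪toL2 g, f⟫_ℝ = 0) : f = 0 := by
  let A : C(Sph d, ℝ) →L[ℝ] ℝ := (innerSL ℝ f).comp (ContinuousMap.toLp 2 (unif d) ℝ)
  have h1 : (⨆ n, harmonics d n).topologicalClosure ≤ LinearMap.ker A.toLinearMap := by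
    refine Submodule.topologicalClosure_minimal _ (iSup_le fun n g hg => ?_) A.isClosed_ker
    have := h n g hg
    rw [real_inner_comm] at this
    exact this
  rw [iSup_harmonics_topologicalClosure hd, top_le_iff] at h1
  refine (toL2_denseRange d).eq_zero_of_inner_right ℝ fun g => ?_
  have : g ∈ LinearMap.ker A.toLinearMap := by rw [h1]; trivial
  rw [real_inner_comm]
  exact this

/-! ### Orthonormal systems of spherical harmonics -/

/-- The image of the spherical harmonics of degree `n` in `L²(𝕊^d)`. -/
def harmonicsL2 (d n : ℕ) : Submodule ℝ (L2 d) :=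
  (harmonics d n).map (ContinuousMap.toLp 2 (unif d) ℝ : C(Sph d, ℝ) →L[ℝ] L2 d).toLinearMap

instance (d n : ℕ) : FiniteDimensional ℝ (harmonicsL2 d n) := by
  unfold harmonicsL2
  infer_instance

theorem finrank_harmonicsL2 {d : ℕ} (hd : 1 ≤ d) (n : ℕ) :
    Module.finrank ℝ (harmonicsL2 d n) = harmDim d n := by
  rw [← finrank_harmonics hd, harmonicsL2, ← LinearMap.range_domRestrict]
  exact LinearMap.finrank_range_of_inj ((toL2_injective d).comp Subtype.val_injective)

theorem exists_isHarmonicSystem {d : ℕ} (hd : 1 ≤ d) :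
    ∃ Y : (n : ℕ) → Fin (harmDim d n) → C(Sph d, ℝ), IsHarmonicSystem Y := by
  let b n := (stdOrthonormalBasis ℝ (harmonicsL2 d n)).reindex (finCongr (finrank_harmonicsL2 hd n))
  choose Y hY using fun n l => (b n l).2
  refine ⟨Y, ⟨fun n => ?_, fun n => ?_⟩⟩
  · have h := (b n).orthonormal.comp_linearIsometry (harmonicsL2 d n).subtypeₗᵢ
    convert! h using 1
    ext1 l
    exact (hY n l).2
  · refine Submodule.map_injective_of_injective (f := (ContinuousMap.toLp 2 (unif d) ℝ :
      C(Sph d, ℝ) →L[ℝ] L2 d).toLinearMap) (toL2_injective d) ?_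
    rw [Submodule.map_span, ← Set.range_comp]
    have h : (ContinuousMap.toLp 2 (unif d) ℝ : C(Sph d, ℝ) →L[ℝ] L2 d).toLinearMap ∘ Y n =
        (harmonicsL2 d n).subtype ∘ b n := by
      ext1 l
      exact (hY n l).2
    rw [h, Set.range_comp, ← Submodule.map_span, ← OrthonormalBasis.coe_toBasis,
      Module.Basis.span_eq, Submodule.map_top, Submodule.range_subtype]
    rfl

section System

variable {d : ℕ} {Y : (n : ℕ) → Fin (harmDim d n) → C(Sph d, ℝ)}

theorem IsHarmonicSystem.mem (hY : IsHarmonicSystem Y) (n : ℕ) (l : Fin (harmDim d n)) :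
    Y n l ∈ harmonics d n := by
  rw [← hY.span_eq n]
  exact Submodule.subset_span ⟨l, rfl⟩

theorem IsHarmonicSystem.orthonormal_sigma (hd : 1 ≤ d) (hY : IsHarmonicSystem Y) :
    Orthonormal ℝ fun i : Σ n, Fin (harmDim d n) => toL2 (Y i.1 i.2) := by
  refine ⟨fun i => (hY.orthonormal i.1).1 i.2, ?_⟩
  rintro ⟨n, l⟩ ⟨m, k⟩ hne
  rcases eq_or_ne n m with rfl | hnm
  · exact (hY.orthonormal n).2 fun h => hne (congrArg (Sigma.mk n) h)
  · simp only [inner_toL2]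
    exact harmonics_orthogonal hd hnm (hY.mem n l) (hY.mem m k)

theorem IsHarmonicSystem.eq_zero (hd : 1 ≤ d) (hY : IsHarmonicSystem Y) {f : L2 d}
    (h : ∀ n l, ⟪toL2 (Y n l), f⟫_ℝ = 0) : f = 0 := by
  refine eq_zero_of_inner_harmonics hd fun n g hg => ?_
  rw [← hY.span_eq n] at hg
  induction hg using Submodule.span_induction with
  | mem g hg =>
    obtain ⟨l, rfl⟩ := hg
    exact h n l
  | zero => rw [toL2_zero, inner_zero_left]
  | add g g' _ _ hg hg' => rw [toL2_add, inner_add_left, hg, hg', add_zero]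
  | smul c g _ hg => rw [toL2_smul, inner_smul_left, hg, mul_zero]

theorem IsHarmonicSystem.complete (hd : 1 ≤ d) (hY : IsHarmonicSystem Y) :
    (Submodule.span ℝ
      (Set.range fun i : Σ n, Fin (harmDim d n) => toL2 (Y i.1 i.2))).topologicalClosure = ⊤ := by
  rw [Submodule.topologicalClosure_eq_top_iff, Submodule.eq_bot_iff]
  intro f hf
  exact hY.eq_zero hd fun n l => hf _ (Submodule.subset_span ⟨⟨n, l⟩, rfl⟩)

/-- The expansion of a spherical harmonic in an orthonormal system. -/
theorem IsHarmonicSystem.expand (hY : IsHarmonicSystem Y) {n : ℕ} {f : C(Sph d, ℝ)}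
    (hf : f ∈ harmonics d n) : f = ∑ l, (∫ y, Y n l y * f y ∂(unif d)) • Y n l := by
  rw [← hY.span_eq n] at hf
  obtain ⟨c, rfl⟩ := (Submodule.mem_span_range_iff_exists_fun ℝ).1 hf
  refine Finset.sum_congr rfl fun l _ => ?_
  congr 1
  rw [← inner_toL2, toL2_sum]
  simp only [toL2_smul]
  exact ((hY.orthonormal n).inner_right_fintype c l).symm

/-- The reproducing kernel `∑ l, Y_{n,l}(x) Y_{n,l}(y)` of the spherical harmonics of degree `n`,
as a function of `x`. -/
def zonal (Y : (n : ℕ) → Fin (harmDim d n) → C(Sph d, ℝ)) (n : ℕ) (y : Sph d) : C(Sph d, ℝ) :=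
  ∑ l, Y n l y • Y n l

theorem zonal_apply (n : ℕ) (x y : Sph d) : zonal Y n y x = ∑ l, Y n l x * Y n l y := by
  simp [zonal, mul_comm]

theorem zonal_comm (n : ℕ) (x y : Sph d) : zonal Y n y x = zonal Y n x y := by
  simp only [zonal_apply, mul_comm]

theorem IsHarmonicSystem.zonal_mem (hY : IsHarmonicSystem Y) (n : ℕ) (y : Sph d) :
    zonal Y n y ∈ harmonics d n :=
  sum_mem fun l _ => Submodule.smul_mem _ _ (hY.mem n l)

/-- The reproducing property of the zonal kernel. -/
theorem IsHarmonicSystem.integral_zonal (hY : IsHarmonicSystem Y) {n : ℕ} {f : C(Sph d, ℝ)}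
    (hf : f ∈ harmonics d n) (y : Sph d) : ∫ x, zonal Y n y x * f x ∂(unif d) = f y := by
  conv_rhs => rw [hY.expand hf]
  rw [ContinuousMap.sum_apply]
  simp only [zonal_apply, Finset.sum_mul, ContinuousMap.smul_apply, smul_eq_mul]
  rw [integral_finsetSum]
  · refine Finset.sum_congr rfl fun l _ => ?_
    rw [← integral_mul_const]
    congr 1
    ext x
    ring
  · intro l _
    exact integrable_continuousMap (Y n l * ContinuousMap.const _ (Y n l y) * f)

/-! ### Rotation invariance -/

theorem comp_rot_mem_harmonicsLT (hd : 1 ≤ d) (R : Amb d ≃ₗᵢ[ℝ] Amb d) {n : ℕ} {f : C(Sph d, ℝ)}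
    (hf : f ∈ harmonicsLT d n) : f.comp (rotMap R) ∈ harmonicsLT d n := by
  have h : harmonicsLT d n ≤ (harmonicsLT d n).comap
      (ContinuousMap.compRightAlgHom ℝ ℝ (rotMap R)).toLinearMap := by
    refine iSup₂_le fun j hj => ?_
    rintro _ ⟨p, hp, rfl⟩
    -- substitute the coordinates of `R x` into `p`
    let g : Fin (d + 1) → MvPolynomial (Fin (d + 1)) ℝ := fun i =>
      ∑ k, C (R (EuclideanSpace.single k 1) i) * X k
    have hg : ∀ i, (g i).IsHomogeneous 1 := fun i =>
      IsHomogeneous.sum _ _ _ fun k _ => isHomogeneous_C_mul_X _ _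
    have hgp := (mem_harmonicPoly.1 hp).1.aeval g hg
    rw [one_mul] at hgp
    have heq : restrict d (aeval g p) = (restrict d p).comp (rotMap R) := by
      ext x
      have hx : ∀ i, eval (fun i => (x : Amb d) i) (g i) = R x i := by
        intro i
        have h1 := (EuclideanSpace.basisFun (Fin (d + 1)) ℝ).sum_repr (x : Amb d)
        conv_rhs => rw [← h1]
        simp [g, mul_comm]
      have ha : ∀ (v : Fin (d + 1) → ℝ) q, eval v q = aeval v q := fun _ _ => rfl
      simp only [ha] at hx
      rw [restrict_apply, ha, comp_aeval_apply]
      simp only [hx]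
      rfl
    rw [Submodule.mem_comap, AlgHom.toLinearMap_apply, ContinuousMap.compRightAlgHom_apply, ← heq]
    exact harmonicsLT_mono d hj (restrict_mem_harmonicsLT hd j _ hgp)
  exact h hf

/-- The spherical harmonics of degree `n` are rotation invariant, being the orthogonal complement
of those of degree `< n` in those of degree `≤ n`. -/
theorem comp_rot_mem_harmonics (hd : 1 ≤ d) (R : Amb d ≃ₗᵢ[ℝ] Amb d) {n : ℕ} {f : C(Sph d, ℝ)}
    (hf : f ∈ harmonics d n) : f.comp (rotMap R) ∈ harmonics d n := by
  have h1 := comp_rot_mem_harmonicsLT hd R (harmonics_le_harmonicsLT n.lt_succ_self hf)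
  rw [Nat.succ_eq_add_one, harmonicsLT_succ] at h1
  obtain ⟨a, ha, b, hb, hab⟩ := Submodule.mem_sup.1 h1
  suffices h : a = 0 by
    rw [← hab, h, zero_add]
    exact hb
  refine eq_zero_of_integral_mul_self ?_
  have h2 : ∀ x, a x * a x = a x * f (rot R x) - a x * b x := by
    intro x
    have : a x + b x = f (rot R x) := DFunLike.congr_fun hab x
    rw [← this]
    ring
  have h4 : ∫ x, a x * f (rot R x) - a x * b x ∂(unif d) =
      ∫ x, a x * f (rot R x) ∂(unif d) - ∫ x, a x * b x ∂(unif d) :=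
    integral_sub (integrable_mul a (f.comp (rotMap R))) (integrable_mul a b)
  rw [integral_congr_ae (Eventually.of_forall h2), h4, harmonicsLT_orthogonal hd le_rfl ha hb,
    sub_zero]
  have h3 := integral_comp_rot R fun x => a (rot R.symm x) * f x
  simp only [rot_symm_rot] at h3
  rw [h3]
  exact harmonicsLT_orthogonal hd le_rfl (comp_rot_mem_harmonicsLT hd R.symm ha) hf

/-- The zonal kernel is rotation invariant: both sides are reproducing kernels of the spherical
harmonics of degree `n`. -/
theorem IsHarmonicSystem.zonal_rot (hd : 1 ≤ d) (hY : IsHarmonicSystem Y)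
    (R : Amb d ≃ₗᵢ[ℝ] Amb d) (n : ℕ) (x y : Sph d) :
    zonal Y n (rot R y) (rot R x) = zonal Y n y x := by
  have h1 := hY.integral_zonal (comp_rot_mem_harmonics hd R (hY.zonal_mem n (rot R y))) x
  have h2 := hY.integral_zonal (comp_rot_mem_harmonics hd R.symm (hY.zonal_mem n x)) (rot R y)
  simp only [ContinuousMap.comp_apply, rotMap_apply, rot_symm_rot] at h1 h2
  rw [← h1, zonal_comm n x y, ← h2,
    ← integral_comp_rot R fun z => zonal Y n (rot R y) z * zonal Y n x (rot R.symm z)]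
  simp only [rot_symm_rot, mul_comm]

end System

end

section

open MvPolynomial

/-! ### Zonal harmonics and the Funk–Hecke formula -/

theorem zero_ne_last {d : ℕ} (hd : 1 ≤ d) : (0 : Fin (d + 1)) ≠ Fin.last d := by
  rw [Ne, Fin.ext_iff, Fin.val_zero, Fin.val_last]
  omega

/-- The point of angle `θ` on the great circle through the first and the last basis vector. -/
def circ {d : ℕ} (hd : 1 ≤ d) (θ : ℝ) : Sph d :=
  ⟨Real.cos θ • EuclideanSpace.single 0 1 + Real.sin θ • EuclideanSpace.single (Fin.last d) 1, by
    rw [mem_sphere_zero_iff_norm, ← sq_eq_sq₀ (norm_nonneg _) zero_le_one, norm_add_sq_real,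
      norm_smul, norm_smul, inner_smul_left, inner_smul_right]
    simp [EuclideanSpace.inner_single_right, zero_ne_last hd]⟩

theorem circ_apply {d : ℕ} (hd : 1 ≤ d) (θ : ℝ) (i : Fin (d + 1)) :
    (circ hd θ : Amb d) i = Real.cos θ * (if i = 0 then 1 else 0) +
      Real.sin θ * (if i = Fin.last d then 1 else 0) := by
  simp [circ, PiLp.single_apply]

theorem continuous_circ {d : ℕ} (hd : 1 ≤ d) : Continuous (circ hd) := by
  unfold circ
  fun_prop

theorem inner_circ {d : ℕ} (hd : 1 ≤ d) (θ : ℝ) :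
    ⟪(circ hd θ : Amb d), circ hd 0⟫_ℝ = Real.cos θ := by
  have h : (circ hd 0 : Amb d) = EuclideanSpace.single 0 1 := by simp [circ]
  rw [h, EuclideanSpace.inner_single_right]
  simp [circ_apply, zero_ne_last hd]

open Polynomial in
/-- On the great circle of the points `circ hd θ`, odd powers of the last coordinate `sin θ` cancel
in the sum over `±θ`, and even powers are polynomials in the first coordinate `cos θ`. -/
theorem exists_polynomial_eval_circ {d : ℕ} (hd : 1 ≤ d) (p : MvPolynomial (Fin (d + 1)) ℝ) :
    ∃ q : ℝ[X], q.natDegree ≤ p.totalDegree ∧ ∀ θ : ℝ,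
      restrict d p (circ hd θ) + restrict d p (circ hd (-θ)) = q.eval (Real.cos θ) := by
  have key : ∀ m : Fin (d + 1) →₀ ℕ, ∃ q : ℝ[X], q.natDegree ≤ m.sum (fun _ e => e) ∧ ∀ θ : ℝ,
      (∏ i, (circ hd θ : Amb d) i ^ m i) + (∏ i, (circ hd (-θ) : Amb d) i ^ m i) =
        q.eval (Real.cos θ) := by
    intro m
    set k := Fin.last d with hk
    have hk0 : k ∈ Finset.univ.erase (0 : Fin (d + 1)) := by simp [hk, (zero_ne_last hd).symm]
    have hprod : ∀ θ, (∏ i, (circ hd θ : Amb d) i ^ m i) = Real.cos θ ^ m 0 * (Real.sin θ ^ m k *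
        ∏ i ∈ (Finset.univ.erase (0 : Fin (d + 1))).erase k, (0 : ℝ) ^ m i) := by
      intro θ
      rw [← Finset.mul_prod_erase _ _ (Finset.mem_univ (0 : Fin (d + 1))),
        ← Finset.mul_prod_erase _ _ hk0]
      congr 1
      · simp [circ_apply, zero_ne_last hd]
      congr 1
      · simp [circ_apply, (zero_ne_last hd).symm, hk]
      · refine Finset.prod_congr rfl fun i hi => ?_
        rw [Finset.mem_erase, Finset.mem_erase] at hi
        simp [circ_apply, hi.1, hi.2.1, ← hk]
    have hdeg : m 0 + m k ≤ m.sum fun _ e => e := by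
      rw [Finsupp.sum_fintype _ _ (fun _ => rfl),
        ← Finset.add_sum_erase _ _ (Finset.mem_univ (0 : Fin (d + 1))),
        ← Finset.add_sum_erase _ _ hk0]
      omega
    set c := ∏ i ∈ (Finset.univ.erase (0 : Fin (d + 1))).erase k, (0 : ℝ) ^ m i
    rcases Nat.even_or_odd' (m k) with ⟨r, hr | hr⟩
    · refine ⟨Polynomial.C (2 * c) * Polynomial.X ^ m 0 * (1 - Polynomial.X ^ 2) ^ r, ?_, ?_⟩
      · refine le_trans ?_ hdeg
        have : ((1 - Polynomial.X ^ 2 : ℝ[X]) ^ r).natDegree ≤ r * 2 :=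
          Polynomial.natDegree_pow_le_of_le r (by compute_degree)
        refine (Polynomial.natDegree_mul_le_of_le (Polynomial.natDegree_C_mul_X_pow_le _ _)
          this).trans (by omega)
      · intro θ
        rw [hprod, hprod, Real.cos_neg, Real.sin_neg, hr, pow_mul, pow_mul, neg_sq, Real.sin_sq]
        simp
        ring
    · refine ⟨0, by simp, fun θ => ?_⟩
      rw [hprod, hprod, Real.cos_neg, Real.sin_neg, hr, Odd.neg_pow ⟨r, rfl⟩]
      simp
  choose q hq hq' using key
  refine ⟨∑ m ∈ p.support, Polynomial.C (coeff m p) * q m, ?_, fun θ => ?_⟩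
  · refine Polynomial.natDegree_sum_le_of_forall_le _ _ fun m hm => ?_
    exact (Polynomial.natDegree_C_mul_le _ _).trans ((hq m).trans (le_totalDegree hm))
  · rw [restrict_apply, restrict_apply, eval_eq', eval_eq', Polynomial.eval_finsetSum,
      ← Finset.sum_add_distrib]
    refine Finset.sum_congr rfl fun m _ => ?_
    rw [← mul_add, hq', Polynomial.eval_mul, Polynomial.eval_C]

section System

variable {d : ℕ} {Y : (n : ℕ) → Fin (harmDim d n) → C(Sph d, ℝ)}

theorem IsHarmonicSystem.zonal_eq_of_inner_eq (hd : 1 ≤ d) (hY : IsHarmonicSystem Y) (n : ℕ)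
    {x y x' y' : Sph d} (h : ⟪(x : Amb d), y⟫_ℝ = ⟪(x' : Amb d), y'⟫_ℝ) :
    zonal Y n y x = zonal Y n y' x' := by
  obtain ⟨R, rfl, rfl⟩ := exists_rot_eq h
  exact (hY.zonal_rot hd R n x y).symm

theorem inner_mem_Icc (x y : Sph d) : ⟪(x : Amb d), y⟫_ℝ ∈ Set.Icc (-1 : ℝ) 1 := by
  have h := abs_real_inner_le_norm (x : Amb d) y
  simp only [norm_eq_of_mem_sphere, mul_one] at h
  exact abs_le.1 h

theorem inner_circ_arccos (hd : 1 ≤ d) (x y : Sph d) :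
    ⟪(circ hd (Real.arccos ⟪(x : Amb d), y⟫_ℝ) : Amb d), circ hd 0⟫_ℝ = ⟪(x : Amb d), y⟫_ℝ := by
  rw [inner_circ, Real.cos_arccos (inner_mem_Icc x y).1 (inner_mem_Icc x y).2]

open Polynomial in
/-- The zonal kernel of degree `n` is a polynomial of degree at most `n` in the inner product.
Rotate the two points onto the points of angle `θ` and `0` of a great circle; as their inner product
`cos θ` is even in `θ`, so is the zonal kernel, which is the restriction of a polynomial. -/
theorem IsHarmonicSystem.exists_zonal_eq_eval (hd : 1 ≤ d) (hY : IsHarmonicSystem Y) (n : ℕ) :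
    ∃ q : ℝ[X], q.natDegree ≤ n ∧ ∀ x y : Sph d, zonal Y n y x = q.eval ⟪(x : Amb d), y⟫_ℝ := by
  obtain ⟨p, hp, hpz⟩ := hY.zonal_mem n (circ hd 0)
  obtain ⟨q, hq, hq'⟩ := exists_polynomial_eval_circ hd p
  refine ⟨Polynomial.C (1 / 2) * q, (Polynomial.natDegree_C_mul_le _ _).trans
    (hq.trans (mem_harmonicPoly.1 hp).1.totalDegree_le), fun x y => ?_⟩
  set θ := Real.arccos ⟪(x : Amb d), y⟫_ℝ with hθ
  have h0 := inner_circ_arccos hd x y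
  rw [← hθ] at h0
  have h1 : zonal Y n y x = restrict d p (circ hd θ) := by
    rw [hpz]
    exact hY.zonal_eq_of_inner_eq hd n h0.symm
  have h2 : zonal Y n y x = restrict d p (circ hd (-θ)) := by
    rw [hpz]
    refine hY.zonal_eq_of_inner_eq hd n ?_
    rw [← h0, inner_circ, inner_circ, Real.cos_neg]
  have h3 := hq' θ
  rw [← h1, ← h2, ← inner_circ hd, h0] at h3
  rw [Polynomial.eval_mul, Polynomial.eval_C, ← h3]
  ring

/-- The addition formula on the diagonal: `∑ l, Y_{n,l}(x)² = N(d, n)`. -/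
theorem IsHarmonicSystem.zonal_self (hd : 1 ≤ d) (hY : IsHarmonicSystem Y) (n : ℕ) (x : Sph d) :
    zonal Y n x x = harmDim d n := by
  have h1 : ∀ y, zonal Y n y y = zonal Y n x x := fun y =>
    hY.zonal_eq_of_inner_eq hd n (by simp)
  have h2 : ∫ y, zonal Y n y y ∂(unif d) = harmDim d n := by
    simp only [zonal_apply]
    rw [integral_finsetSum _ fun l _ => integrable_mul (Y n l) (Y n l)]
    simp only [← inner_toL2, real_inner_self_eq_norm_sq, (hY.orthonormal n).1]
    simp
  simpa [h1] using h2

open Polynomial in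
/-- The zonal functions `Z_n(·, y)` at a fixed `y` are orthogonal and do not vanish at `y`. -/
theorem IsHarmonicSystem.linearIndependent_zonal (hd : 1 ≤ d) (hY : IsHarmonicSystem Y)
    {q : ℕ → ℝ[X]} (hq : ∀ n, ∀ x y : Sph d, zonal Y n y x = (q n).eval ⟪(x : Amb d), y⟫_ℝ) :
    LinearIndependent ℝ q := by
  rw [linearIndependent_iff']
  intro s g hg i hi
  have h1 : ∑ j ∈ s, g j • zonal Y j (circ hd 0) = 0 := by
    ext x
    have := congrArg (Polynomial.eval ⟪(x : Amb d), circ hd 0⟫_ℝ) hg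
    simpa [Polynomial.eval_finsetSum, ← hq] using this
  have h2 := congrArg (fun f => ⟪toL2 (zonal Y i (circ hd 0)), toL2 f⟫_ℝ) h1
  simp only [toL2_sum, toL2_smul, inner_sum, inner_smul_right, toL2_zero, inner_zero_right] at h2
  rw [Finset.sum_eq_single_of_mem i hi] at h2
  · rw [inner_toL2, hY.integral_zonal (hY.zonal_mem i _), hY.zonal_self hd] at h2
    exact (mul_eq_zero.1 h2).resolve_right (Nat.cast_ne_zero.2 (harmDim_pos hd i).ne')
  · intro j _ hj
    rw [inner_toL2, harmonics_orthogonal hd hj.symm (hY.zonal_mem _ _) (hY.zonal_mem _ _), mul_zero]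

open Polynomial in
/-- The zonal polynomials of degrees `< k` form a basis of the polynomials of degree `< k`, by
counting dimensions. -/
theorem IsHarmonicSystem.exists_eq_sum_zonal (hd : 1 ≤ d) (hY : IsHarmonicSystem Y)
    {q : ℕ → ℝ[X]} (hq : ∀ n, ∀ x y : Sph d, zonal Y n y x = (q n).eval ⟪(x : Amb d), y⟫_ℝ)
    (hdeg : ∀ n, (q n).natDegree ≤ n) {P : ℝ[X]} {k : ℕ} (hP : P.natDegree < k) :
    ∃ c : Fin k → ℝ, P = ∑ j, c j • q j := by
  have hli : LinearIndependent ℝ fun j : Fin k => q j :=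
    (hY.linearIndependent_zonal hd hq).comp _ Fin.val_injective
  have hfd : Module.finrank ℝ (Polynomial.degreeLT ℝ k) = k := by
    rw [(Polynomial.degreeLTEquiv ℝ k).finrank_eq, Module.finrank_fin_fun]
  have : FiniteDimensional ℝ (Polynomial.degreeLT ℝ k) :=
    (Polynomial.degreeLTEquiv ℝ k).symm.finiteDimensional
  have hspan : Submodule.span ℝ (Set.range fun j : Fin k => q j) = Polynomial.degreeLT ℝ k := by
    refine Submodule.eq_of_le_of_finrank_eq ?_ ?_
    · rw [Submodule.span_le]
      rintro _ ⟨j, rfl⟩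
      rw [SetLike.mem_coe, Polynomial.mem_degreeLT]
      exact Polynomial.degree_le_natDegree.trans_lt
        (Nat.cast_lt.2 ((hdeg j).trans_lt j.2))
    · rw [finrank_span_eq_card hli, hfd, Fintype.card_fin]
  have hmem : P ∈ Submodule.span ℝ (Set.range fun j : Fin k => q j) := by
    rw [hspan, Polynomial.mem_degreeLT]
    exact Polynomial.degree_le_natDegree.trans_lt (Nat.cast_lt.2 hP)
  obtain ⟨c, hc⟩ := (Submodule.mem_span_range_iff_exists_fun ℝ).1 hmem
  exact ⟨c, hc.symm⟩

end System

open Polynomial in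
/-- The Funk–Hecke formula for a polynomial kernel `P(⟪x, ξ⟫)`: expand `P` in zonal polynomials, of
which only the one of degree `n` contributes. -/
theorem exists_integral_polynomial_mul {d : ℕ} (hd : 1 ≤ d) (P : ℝ[X]) (n : ℕ) :
    ∃ c : ℝ, ∀ f ∈ harmonics d n, ∀ x : Sph d,
      ∫ ξ : Sph d, P.eval ⟪(x : Amb d), (ξ : Amb d)⟫_ℝ * f ξ ∂(unif d) = c * f x := by
  obtain ⟨Y, hY⟩ := exists_isHarmonicSystem hd
  choose q hdeg hq using hY.exists_zonal_eq_eval hd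
  obtain ⟨c, hc⟩ := hY.exists_eq_sum_zonal hd hq hdeg (P := P) (k := P.natDegree + n + 1)
    (by omega)
  refine ⟨c ⟨n, by omega⟩, fun f hf x => ?_⟩
  have h1 : ∀ ξ : Sph d, P.eval ⟪(x : Amb d), (ξ : Amb d)⟫_ℝ * f ξ =
      ∑ j, c j * (zonal Y j x ξ * f ξ) := by
    intro ξ
    conv_lhs => rw [hc]
    rw [real_inner_comm, Polynomial.eval_finsetSum, Finset.sum_mul]
    refine Finset.sum_congr rfl fun j _ => ?_
    rw [Polynomial.eval_smul, hq, smul_eq_mul, mul_assoc]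
  simp only [h1]
  rw [integral_finsetSum _ fun (j : Fin _) _ =>
    (integrable_mul (zonal Y (j : ℕ) x) f).const_mul (c j)]
  simp only [integral_const_mul]
  rw [Finset.sum_eq_single ⟨n, by omega⟩]
  · rw [hY.integral_zonal hf]
  · intro j _ hj
    rw [harmonics_orthogonal hd (fun h => hj (Fin.ext h)) (hY.zonal_mem _ _) hf, mul_zero]
  · simp

/-- The Funk–Hecke formula: the spherical harmonics of degree `n` are eigenfunctions of the
integral operator, for a common eigenvalue. -/
theorem exists_integral_mul_harmonics {d : ℕ} (hd : 1 ≤ d) {K : C(Sph d × Sph d, ℝ)}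
    (hK : IsInnerProductKernel K) (n : ℕ) :
    ∃ μ : ℝ, ∀ f ∈ harmonics d n, ∀ x : Sph d,
      ∫ ξ, K (x, ξ) * f ξ ∂(unif d) = μ * f x := by
  obtain ⟨Φ, hΦ⟩ := hK.exists_profile
  have hΦc : ContinuousOn Φ (Set.Icc (-1) 1) := by
    have h1 : Continuous fun t => K (circ hd (Real.arccos t), circ hd 0) :=
      K.continuous.comp (((continuous_circ hd).comp Real.continuous_arccos).prodMk
        continuous_const)
    refine h1.continuousOn.congr fun t ht => ?_
    simp only
    rw [hΦ, inner_circ, Real.cos_arccos ht.1 ht.2]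
  choose P hP using fun j : ℕ => exists_polynomial_near_of_continuousOn (-1) 1 Φ hΦc
    (1 / ((j : ℝ) + 1)) (by positivity)
  choose c hc using fun j => exists_integral_polynomial_mul hd (P j) n
  have hlim : ∀ f ∈ harmonics d n, ∀ x : Sph d,
      Tendsto (fun j => c j * f x) atTop (𝓝 (∫ ξ, K (x, ξ) * f ξ ∂(unif d))) := by
    intro f hf x
    rw [tendsto_iff_norm_sub_tendsto_zero]
    refine squeeze_zero (fun _ => norm_nonneg _) (g := fun j : ℕ => 1 / ((j : ℝ) + 1) * ‖f‖)
      (fun j => ?_) ?_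
    · have hi : Integrable (fun ξ : Sph d => (P j).eval ⟪(x : Amb d), (ξ : Amb d)⟫_ℝ * f ξ)
          (unif d) := integrable_mul
        ⟨fun ξ : Sph d => (P j).eval ⟪(x : Amb d), (ξ : Amb d)⟫_ℝ, by fun_prop⟩ f
      have hi' : Integrable (fun ξ : Sph d => K (x, ξ) * f ξ) (unif d) := integrable_mul (sec K x) f
      rw [← hc j f hf x, ← integral_sub hi hi']
      refine (norm_integral_le_of_norm_le_const (C := 1 / ((j : ℝ) + 1) * ‖f‖)
        (Eventually.of_forall fun ξ => ?_)).trans (by simp)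
      rw [hΦ, ← sub_mul, norm_mul]
      exact mul_le_mul (hP j _ (inner_mem_Icc x ξ)).le (f.norm_coe_le_norm ξ) (norm_nonneg _)
        (by positivity)
    · simpa using tendsto_one_div_add_atTop_nhds_zero_nat.mul_const ‖f‖
  by_cases h : ∃ f ∈ harmonics d n, ∃ x, f x ≠ 0
  · obtain ⟨f₀, hf₀, x₀, h₀⟩ := h
    have hμ := (hlim f₀ hf₀ x₀).mul_const (f₀ x₀)⁻¹
    simp only [mul_inv_cancel_right₀ h₀] at hμ
    exact ⟨_, fun f hf x => tendsto_nhds_unique (hlim f hf x) (hμ.mul_const (f x))⟩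
  · push Not at h
    exact ⟨0, fun f hf x => by simp [h f hf]⟩

end

/-! ### Mercer's theorem -/

/-- A positive semidefinite kernel is the Gram kernel of a map to a Hilbert space, namely its
reproducing kernel Hilbert space. -/
theorem exists_featureMap {X : Type} {k : X → X → ℝ} (hk : (Matrix.of k).PosSemidef) :
    ∃ (H : Type) (_ : NormedAddCommGroup H) (_ : InnerProductSpace ℝ H) (_ : CompleteSpace H)
      (Ψ : X → H), ∀ x y, ⟪Ψ x, Ψ y⟫_ℝ = k x y := by
  let M : Matrix X X (ℝ →L[ℝ] ℝ) := Matrix.of fun x y => k x y • (1 : ℝ →L[ℝ] ℝ)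
  have hsymm : ∀ x y, k x y = k y x := fun x y => by
    simpa using (hk.1.apply x y).symm
  have hM : M.PosSemidef := by
    have h02 := (RKHS.posSemidef_tfae (K := M)).out 0 2
    refine h02.2 ⟨?_, fun v => ?_⟩
    · ext x y
      simp [M, Matrix.conjTranspose_apply, hsymm x y]
    · have h := hk.2 v
      simp only [Matrix.of_apply, star_trivial] at h
      refine h.trans_eq ?_
      simp only [M, Matrix.of_apply, RCLike.re_to_real]
      refine Finset.sum_congr rfl fun x _ => Finset.sum_congr rfl fun y _ => ?_
      simp [hsymm x y]
      ring
  have : Fact M.PosSemidef := ⟨hM⟩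
  refine ⟨RKHS.OfKernel M, inferInstance, inferInstance, inferInstance,
    fun x => RKHS.kerFun (RKHS.OfKernel M) x (1 : ℝ), fun x y => ?_⟩
  rw [RKHS.kerFun_inner, RKHS.kerFun_apply, RKHS.OfKernel.kernel_ofKernel]
  simp [M]

theorem continuous_of_continuous_inner {X H : Type*} [TopologicalSpace X] [NormedAddCommGroup H]
    [InnerProductSpace ℝ H] {Ψ : X → H} (h : Continuous fun p : X × X => ⟪Ψ p.1, Ψ p.2⟫_ℝ) :
    Continuous Ψ := by
  rw [continuous_iff_continuousAt]
  intro x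
  rw [ContinuousAt, tendsto_iff_norm_sub_tendsto_zero]
  have h1 : Continuous fun y => √(⟪Ψ y, Ψ y⟫_ℝ - 2 * ⟪Ψ y, Ψ x⟫_ℝ + ⟪Ψ x, Ψ x⟫_ℝ) :=
    (((h.comp (continuous_id.prodMk continuous_id)).sub
      ((h.comp (continuous_id.prodMk continuous_const)).const_mul 2)).add continuous_const).sqrt
  have h2 : ∀ y, √(⟪Ψ y, Ψ y⟫_ℝ - 2 * ⟪Ψ y, Ψ x⟫_ℝ + ⟪Ψ x, Ψ x⟫_ℝ) = ‖Ψ y - Ψ x‖ := by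
    intro y
    rw [real_inner_self_eq_norm_sq, real_inner_self_eq_norm_sq, ← norm_sub_sq_real,
      Real.sqrt_sq (norm_nonneg _)]
  simp only [h2] at h1
  simpa using h1.tendsto x

section Mercer

variable {d : ℕ} {K : C(Sph d × Sph d, ℝ)} {m : ℕ → ℝ}
  {Y : (n : ℕ) → Fin (harmDim d n) → C(Sph d, ℝ)}

/-- Bessel's inequality in the feature space, for the vectors `g_i = ∫ Y_i(y) Ψ(y) dy`, which
satisfy `⟪Ψ(x), g_i⟫ = m_i Y_i(x)` and are orthogonal with `‖g_i‖² = m_i`. -/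
theorem mercer_nonneg_and_bessel (hd : 1 ≤ d) (hK : IsInnerProductKernel K)
    (hm : ∀ n, ∀ f ∈ harmonics d n, ∀ x : Sph d, ∫ ξ, K (x, ξ) * f ξ ∂(unif d) = m n * f x)
    (hY : IsHarmonicSystem Y) :
    (∀ n, 0 ≤ m n) ∧ ∀ (s : Finset (Σ n, Fin (harmDim d n))) (x : Sph d),
      ∑ i ∈ s, m i.1 * Y i.1 i.2 x ^ 2 ≤ K (x, x) := by
  classical
  obtain ⟨H, _, _, _, Ψ, hΨ⟩ := exists_featureMap (k := fun x y => K (x, y)) hK.posSemidef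
  have hΨc : Continuous Ψ := continuous_of_continuous_inner (by
    simp only [hΨ]
    exact K.continuous)
  have hint : ∀ f : C(Sph d, ℝ), Integrable (fun y => f y • Ψ y) (unif d) := fun f =>
    (f.continuous.smul hΨc).integrable_of_hasCompactSupport (HasCompactSupport.of_compactSpace _)
  let g : (Σ n, Fin (harmDim d n)) → H := fun i => ∫ y, Y i.1 i.2 y • Ψ y ∂(unif d)
  have h1 : ∀ x i, ⟪Ψ x, g i⟫_ℝ = m i.1 * Y i.1 i.2 x := by
    intro x i
    rw [← hm i.1 _ (hY.mem i.1 i.2) x, ← integral_inner (hint _)]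
    simp only [inner_smul_right, hΨ, mul_comm]
  have h2 : ∀ i j, ⟪g i, g j⟫_ℝ = if i = j then m i.1 else 0 := by
    intro i j
    have h3 : ⟪g i, g j⟫_ℝ = m j.1 * ⟪toL2 (Y i.1 i.2), toL2 (Y j.1 j.2)⟫_ℝ := by
      rw [real_inner_comm, ← integral_inner (hint _), inner_toL2, ← integral_const_mul]
      refine integral_congr_ae (Eventually.of_forall fun y => ?_)
      simp only [inner_smul_right, real_inner_comm, h1]
      ring
    rw [h3, orthonormal_iff_ite.1 (hY.orthonormal_sigma hd) i j]
    split_ifs with h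
    · rw [h, mul_one]
    · rw [mul_zero]
  refine ⟨fun n => ?_, fun s x => ?_⟩
  · have := h2 ⟨n, ⟨0, harmDim_pos hd n⟩⟩ ⟨n, ⟨0, harmDim_pos hd n⟩⟩
    rw [if_pos rfl] at this
    rw [← this]
    exact real_inner_self_nonneg
  · have h4 : ⟪Ψ x, ∑ i ∈ s, Y i.1 i.2 x • g i⟫_ℝ = ∑ i ∈ s, m i.1 * Y i.1 i.2 x ^ 2 := by
      rw [inner_sum]
      refine Finset.sum_congr rfl fun i _ => ?_
      rw [inner_smul_right, h1]
      ring
    have h5 : ‖∑ i ∈ s, Y i.1 i.2 x • g i‖ ^ 2 = ∑ i ∈ s, m i.1 * Y i.1 i.2 x ^ 2 := by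
      rw [← real_inner_self_eq_norm_sq, sum_inner]
      refine Finset.sum_congr rfl fun i hi => ?_
      simp only [inner_sum, inner_smul_left, inner_smul_right, h2]
      simp only [mul_ite, mul_zero, Finset.sum_ite_eq, if_pos hi]
      simp only [conj_trivial]
      ring
    have h6 := sq_nonneg ‖Ψ x - ∑ i ∈ s, Y i.1 i.2 x • g i‖
    rw [norm_sub_sq_real, h4, h5, ← real_inner_self_eq_norm_sq, hΨ] at h6
    linarith

theorem IsHarmonicSystem.abs_zonal_le (hd : 1 ≤ d) (hY : IsHarmonicSystem Y) (n : ℕ)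
    (x y : Sph d) : |zonal Y n y x| ≤ harmDim d n := by
  have hx := hY.zonal_self hd n x
  have hy := hY.zonal_self hd n y
  rw [zonal_apply] at hx hy ⊢
  calc |∑ l, Y n l x * Y n l y| ≤ ∑ l, |Y n l x * Y n l y| := Finset.abs_sum_le_sum_abs _ _
    _ ≤ ∑ l, (Y n l x * Y n l x + Y n l y * Y n l y) / 2 := by
      refine Finset.sum_le_sum fun l _ => abs_le.2 ⟨?_, ?_⟩
      · nlinarith [sq_nonneg (Y n l x + Y n l y)]
      · nlinarith [sq_nonneg (Y n l x - Y n l y)]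
    _ = harmDim d n := by
      rw [← Finset.sum_div, Finset.sum_add_distrib, hx, hy]
      ring

theorem mercer_summable_harmDim (hd : 1 ≤ d) (hK : IsInnerProductKernel K)
    (hm : ∀ n, ∀ f ∈ harmonics d n, ∀ x : Sph d, ∫ ξ, K (x, ξ) * f ξ ∂(unif d) = m n * f x)
    (hY : IsHarmonicSystem Y) : Summable fun n => m n * harmDim d n := by
  obtain ⟨h0, hB⟩ := mercer_nonneg_and_bessel hd hK hm hY
  refine summable_of_sum_le (c := K (circ hd 0, circ hd 0))
    (fun n => mul_nonneg (h0 n) (Nat.cast_nonneg _)) fun s => ?_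
  refine le_trans (le_of_eq ?_) (hB (s.sigma fun _ => Finset.univ) (circ hd 0))
  rw [Finset.sum_sigma]
  refine Finset.sum_congr rfl fun n _ => ?_
  rw [← hY.zonal_self hd n (circ hd 0), zonal_apply, Finset.mul_sum]
  exact Finset.sum_congr rfl fun l _ => by rw [sq]

/-- The Mercer expansion holds pointwise: both sides are continuous in `y` and have the same
coefficients with respect to the orthonormal basis of spherical harmonics. -/
theorem mercer_hasSum (hd : 1 ≤ d) (hK : IsInnerProductKernel K)
    (hm : ∀ n, ∀ f ∈ harmonics d n, ∀ x : Sph d, ∫ ξ, K (x, ξ) * f ξ ∂(unif d) = m n * f x)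
    (hY : IsHarmonicSystem Y) (x y : Sph d) : HasSum (fun n => m n * zonal Y n x y) (K (x, y)) := by
  obtain ⟨h0, -⟩ := mercer_nonneg_and_bessel hd hK hm hY
  have hs : Summable fun n => m n • zonal Y n x := by
    refine Summable.of_norm_bounded (mercer_summable_harmDim hd hK hm hY) fun n => ?_
    rw [norm_smul, Real.norm_of_nonneg (h0 n)]
    refine mul_le_mul_of_nonneg_left ?_ (h0 n)
    exact (ContinuousMap.norm_le _ (Nat.cast_nonneg _)).2 fun z => hY.abs_zonal_le hd n z x
  obtain ⟨S, hS⟩ := hs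
  have hSK : S = sec K x := by
    refine toL2_injective d (sub_eq_zero.1 (hY.eq_zero hd fun n l => ?_))
    have h1 : HasSum (fun j => ⟪toL2 (Y n l), toL2 (m j • zonal Y j x)⟫_ℝ)
        ⟪toL2 (Y n l), toL2 S⟫_ℝ :=
      hS.mapL ((innerSL ℝ (toL2 (Y n l))).comp (ContinuousMap.toLp 2 (unif d) ℝ))
    have h2 : HasSum (fun j => ⟪toL2 (Y n l), toL2 (m j • zonal Y j x)⟫_ℝ)
        ⟪toL2 (Y n l), toL2 (m n • zonal Y n x)⟫_ℝ := by
      refine hasSum_single n fun j hj => ?_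
      rw [toL2_smul, inner_smul_right, inner_toL2,
        harmonics_orthogonal hd hj.symm (hY.mem n l) (hY.zonal_mem j x), mul_zero]
    rw [inner_sub_right, h1.unique h2, toL2_smul, inner_smul_right, real_inner_comm, inner_toL2,
      hY.integral_zonal (hY.mem n l), real_inner_comm, inner_toL2, ← hm n _ (hY.mem n l) x]
    exact sub_self _
  have := hS.mapL (ContinuousMap.evalCLM ℝ y)
  rw [hSK] at this
  simpa using! this

theorem exists_isMercerCoeff (hd : 1 ≤ d) (hK : IsInnerProductKernel K) :
    ∃ m : ℕ → ℝ, IsMercerCoeff K m := by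
  choose m hm using exists_integral_mul_harmonics hd hK
  refine ⟨m, exists_isHarmonicSystem hd, ?_, fun Y hY => hY.orthonormal_sigma hd,
    fun Y hY => hY.complete hd, fun Y hY n l x => hm n _ (hY.mem n l) x, fun Y hY x y => ?_,
    fun Y hY => ?_⟩
  · obtain ⟨Y, hY⟩ := exists_isHarmonicSystem hd
    exact (mercer_nonneg_and_bessel hd hK hm hY).1
  · obtain ⟨h0, hB⟩ := mercer_nonneg_and_bessel hd hK hm hY
    have hs : ∀ x, Summable fun i : Σ n, Fin (harmDim d n) => m i.1 * Y i.1 i.2 x ^ 2 := fun x =>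
      summable_of_sum_le (fun i => mul_nonneg (h0 i.1) (sq_nonneg _)) fun s => hB s x
    refine Summable.of_nonneg_of_le (fun _ => abs_nonneg _) (fun i => ?_)
      (((hs x).add (hs y)).div_const 2)
    rw [abs_mul, abs_of_nonneg (h0 i.1), ← mul_add, mul_div_assoc]
    refine mul_le_mul_of_nonneg_left (abs_le.2 ⟨?_, ?_⟩) (h0 i.1)
    · nlinarith [sq_nonneg (Y i.1 i.2 x + Y i.1 i.2 y)]
    · nlinarith [sq_nonneg (Y i.1 i.2 x - Y i.1 i.2 y)]
  · obtain ⟨h0, -⟩ := mercer_nonneg_and_bessel hd hK hm hY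
    have h := tendstoUniformly_tsum_nat (f := fun n (p : Sph d × Sph d) =>
      m n * ∑ l, Y n l p.1 * Y n l p.2) (mercer_summable_harmDim hd hK hm hY) fun n p => ?_
    · have heq : (fun p : Sph d × Sph d => ∑' n, m n * ∑ l, Y n l p.1 * Y n l p.2) = K := by
        ext p
        have := (mercer_hasSum hd hK hm hY p.1 p.2).tsum_eq
        simp only [zonal_comm _ p.2, zonal_apply] at this
        exact this
      rwa [heq] at h
    · rw [norm_mul, Real.norm_of_nonneg (h0 n), ← zonal_apply]
      exact mul_le_mul_of_nonneg_left (hY.abs_zonal_le hd n _ _) (h0 n)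

end Mercer

/-! ### Counting spherical harmonics -/

theorem choose_add_le_pow (n d : ℕ) : (n + d).choose d ≤ (n + 1) ^ d := by
  induction d with
  | zero => simp
  | succ d ih =>
    refine Nat.le_of_mul_le_mul_right ?_ d.succ_pos
    have h := Nat.add_one_mul_choose_eq (n + d) d
    rw [← add_assoc, ← h, pow_succ]
    have h2 : n + d + 1 ≤ (n + 1) * (d + 1) := by nlinarith [Nat.zero_le (n * d)]
    calc (n + d + 1) * (n + d).choose d ≤ ((n + 1) * (d + 1)) * (n + 1) ^ d :=
          Nat.mul_le_mul h2 ih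
      _ = (n + 1) ^ d * (n + 1) * (d + 1) := by ring

theorem pow_le_factorial_mul_choose (n d : ℕ) :
    (n + 1) ^ d ≤ d.factorial * (n + d).choose d := by
  rw [← Nat.ascFactorial_eq_factorial_mul_choose]
  exact Nat.pow_succ_le_ascFactorial _ _

/-- The sum telescopes, up to the last two terms, since `N(d, j)` is `C(j + d, d) - C(j - 2 + d, d)`
for `j ≥ 2`. -/
theorem sum_harmDim_succ (d n : ℕ) : ∑ j ∈ Finset.range (n + 1), harmDim d j =
    (n + d).choose d + if 1 ≤ n then (n - 1 + d).choose d else 0 := by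
  induction n with
  | zero => simp [harmDim]
  | succ n ih =>
    rw [Finset.sum_range_succ, ih, harmDim, if_pos (show 1 ≤ n + 1 by omega), Nat.add_sub_cancel,
      ← Nat.choose_symm_add (a := n + 1)]
    rcases n with _ | n
    · simp
      ring
    · have h1 : n + 1 + 1 + d - 2 = n + d := by omega
      have h2 : n + 1 + 1 - 2 = n := by omega
      have h3 : (n + d).choose n ≤ (n + 1 + 1 + d).choose (n + 1 + 1) := by
        rw [Nat.choose_symm_add, Nat.choose_symm_add]
        exact Nat.choose_le_choose d (by omega)
      rw [if_pos (by omega), if_pos (by omega), h1, h2, Nat.add_sub_cancel,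
        ← Nat.choose_symm_add (a := n)]
      omega

theorem sum_harmDim_le (d n : ℕ) :
    ∑ j ∈ Finset.range n, harmDim d j ≤ 2 * n ^ d := by
  rcases n with _ | n
  · simp
  rw [sum_harmDim_succ, two_mul]
  refine Nat.add_le_add (choose_add_le_pow n d) ?_
  split_ifs with h
  · exact (Nat.choose_le_choose d (by omega)).trans (choose_add_le_pow n d)
  · exact Nat.zero_le _

theorem pow_le_factorial_mul_sum_harmDim {d : ℕ} (hd : 1 ≤ d) (n : ℕ) :
    n ^ d ≤ d.factorial * ∑ j ∈ Finset.range n, harmDim d j := by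
  rcases n with _ | n
  · simp [zero_pow (by omega : d ≠ 0)]
  rw [sum_harmDim_succ]
  exact (pow_le_factorial_mul_choose n d).trans (Nat.mul_le_mul_left _ (Nat.le_add_right _ _))

/-- The indices of the spherical harmonics of degree less than `n`. -/
def idxLT (d n : ℕ) : Finset (Σ n, Fin (harmDim d n)) := (Finset.range n).sigma fun _ => Finset.univ

theorem mem_idxLT {d n : ℕ} {i : Σ n, Fin (harmDim d n)} : i ∈ idxLT d n ↔ i.1 < n := by
  simp [idxLT]

theorem card_idxLT (d n : ℕ) : (idxLT d n).card = ∑ j ∈ Finset.range n, harmDim d j := by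
  simp [idxLT]

/-! ### Sorting and two-sided bounds -/

/-- A positive function on an infinite set with finite superlevel sets can be listed in
nonincreasing order. -/
theorem exists_equiv_antitone {I : Type*} [Infinite I] {a : I → ℝ} (ha : ∀ i, 0 < a i)
    (hfin : ∀ ε > 0, {i | ε ≤ a i}.Finite) : ∃ e : ℕ ≃ I, Antitone (a ∘ e) := by
  have hc : Countable I := by
    have : (Set.univ : Set I) = ⋃ n : ℕ, {i | 1 / ((n : ℝ) + 1) ≤ a i} := by
      ext i
      simp only [Set.mem_univ, Set.mem_iUnion, Set.mem_ofPred_eq, true_iff]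
      obtain ⟨n, hn⟩ := exists_nat_one_div_lt (ha i)
      exact ⟨n, hn.le⟩
    rw [← Set.countable_univ_iff, this]
    exact Set.countable_iUnion fun n => (hfin _ (by positivity)).countable
  obtain ⟨f, hf⟩ := exists_injective_nat I
  -- order by decreasing values, breaking ties by the index
  let g : I → ℝᵒᵈ ×ₗ ℕ := fun i => toLex (OrderDual.toDual (a i), f i)
  have hg : Function.Injective g := fun i j h => hf (congrArg (fun p => (ofLex p).2) h)
  let _ : LinearOrder I := LinearOrder.lift' g hg
  have hle : ∀ i j : I, i ≤ j → a j ≤ a i := by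
    intro i j h
    have h' : g i ≤ g j := h
    rcases (Prod.Lex.toLex_le_toLex.1 h') with h1 | h1
    · exact (OrderDual.toDual_lt_toDual.1 h1).le
    · exact (OrderDual.toDual_inj.1 h1.1).ge
  have hIic : ∀ i : I, (Set.Iic i).Finite := fun i =>
    (hfin (a i) (ha i)).subset fun j hj => hle j i hj
  let _ : LocallyFiniteOrder I := LocallyFiniteOrder.ofFiniteIcc fun i j =>
    (hIic j).subset Set.Icc_subset_Iic_self
  let _ : NoMaxOrder I := ⟨fun i => by
    by_contra! h
    exact Set.infinite_univ ((hIic i).subset fun j _ => h j)⟩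
  let _ : SuccOrder I := LinearLocallyFiniteOrder.succOrder I
  let _ : PredOrder I := LinearLocallyFiniteOrder.predOrder I
  obtain ⟨i₀⟩ : Nonempty I := inferInstance
  obtain ⟨b, hb, hb'⟩ := Set.exists_min_image (Set.Iic i₀) id (hIic i₀) ⟨i₀, Set.self_mem_Iic⟩
  let _ : OrderBot I :=
    { bot := b, bot_le := fun i => (le_total i i₀).elim (hb' i) fun h => le_trans hb h }
  exact ⟨orderIsoNatOfLinearSuccPredArch.symm.toEquiv, fun i j hij =>
    hle _ _ (orderIsoNatOfLinearSuccPredArch.symm.monotone hij)⟩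

theorem rpow_neg_mul_eq {x : ℝ} (hx : 0 ≤ x) (d : ℕ) (β : ℝ) :
    x ^ (-((d : ℝ) * β)) = (x ^ d) ^ (-β) := by
  rw [← mul_neg, Real.rpow_mul hx, Real.rpow_natCast]

/-- The lower bound is stated in terms of `(n + 1)^d`, which counts the harmonics of degree at most
`n` up to constants. It can only hold for large `n`, since `m` may vanish at small ones. -/
theorem exists_lower_bound_of_isTheta {d : ℕ} {m : ℕ → ℝ} (h0 : ∀ n, 0 ≤ m n) {β : ℝ} (hβ : 0 < β)
    (h : Asymptotics.IsTheta atTop m (fun n : ℕ => (n : ℝ) ^ (-((d : ℝ) * β)))) :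
    ∃ A : ℝ, 0 < A ∧ ∃ n₀ : ℕ, ∀ n, n₀ ≤ n → A * (((n : ℝ) + 1) ^ d) ^ (-β) ≤ m n := by
  obtain ⟨C, hC, hb⟩ := h.2.exists_pos
  rw [Asymptotics.isBigOWith_iff, eventually_atTop] at hb
  obtain ⟨n₀, hn₀⟩ := hb
  refine ⟨C⁻¹, inv_pos.2 hC, max n₀ 1, fun n hn => ?_⟩
  have hn1 : (0 : ℝ) < n := Nat.cast_pos.2 (by omega)
  have h1 := hn₀ n (by omega)
  rw [Real.norm_of_nonneg (h0 n), Real.norm_of_nonneg (by positivity), rpow_neg_mul_eq hn1.le] at h1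
  rw [inv_mul_le_iff₀ hC]
  refine le_trans (Real.rpow_le_rpow_of_nonpos (by positivity) ?_ (by linarith)) h1
  gcongr
  linarith

theorem exists_upper_bound_of_isTheta {d : ℕ} {m : ℕ → ℝ} (h0 : ∀ n, 0 ≤ m n) {β : ℝ} (hβ : 0 < β)
    (h : Asymptotics.IsTheta atTop m (fun n : ℕ => (n : ℝ) ^ (-((d : ℝ) * β)))) :
    ∃ A : ℝ, 0 < A ∧ ∀ n : ℕ, m n ≤ A * (((n : ℝ) + 1) ^ d) ^ (-β) := by
  obtain ⟨C, hC, hb⟩ := h.1.exists_pos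
  rw [Asymptotics.isBigOWith_iff, eventually_atTop] at hb
  obtain ⟨n₀, hn₀⟩ := hb
  have hpos : ∀ n : ℕ, (0 : ℝ) < (((n : ℝ) + 1) ^ d) ^ β := fun n => by positivity
  -- the finitely many initial terms are absorbed into the constant
  refine ⟨C * (2 ^ d) ^ β + ∑ j ∈ Finset.range (n₀ + 1), m j * (((j : ℝ) + 1) ^ d) ^ β,
    add_pos_of_pos_of_nonneg (by positivity)
      (Finset.sum_nonneg fun j _ => mul_nonneg (h0 j) (hpos j).le), fun n => ?_⟩
  rw [Real.rpow_neg (by positivity), ← div_eq_mul_inv, le_div_iff₀ (hpos n)]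
  have hs : 0 ≤ ∑ j ∈ Finset.range (n₀ + 1), m j * (((j : ℝ) + 1) ^ d) ^ β :=
    Finset.sum_nonneg fun j _ => mul_nonneg (h0 j) (hpos j).le
  rcases lt_or_ge n (n₀ + 1) with hn | hn
  · have h1 := Finset.single_le_sum (f := fun j : ℕ => m j * (((j : ℝ) + 1) ^ d) ^ β)
      (fun j _ => mul_nonneg (h0 j) (hpos j).le) (Finset.mem_range.2 hn)
    have h2 : 0 ≤ C * ((2 : ℝ) ^ d) ^ β := by positivity
    linarith
  · have hn1 : (1 : ℝ) ≤ n := Nat.one_le_cast.2 (by omega)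
    have h1 := hn₀ n (by omega)
    rw [Real.norm_of_nonneg (h0 n), Real.norm_of_nonneg (by positivity),
      rpow_neg_mul_eq (by linarith), Real.rpow_neg (by positivity)] at h1
    have h2 : (((n : ℝ) + 1) ^ d) ^ β ≤ (2 ^ d) ^ β * ((n : ℝ) ^ d) ^ β := by
      rw [← Real.mul_rpow (by positivity) (by positivity), ← mul_pow]
      gcongr
      linarith
    have h3 : (0 : ℝ) < ((n : ℝ) ^ d) ^ β := by positivity
    calc m n * (((n : ℝ) + 1) ^ d) ^ β
        ≤ (C * (((n : ℝ) ^ d) ^ β)⁻¹) * ((2 ^ d) ^ β * ((n : ℝ) ^ d) ^ β) :=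
          mul_le_mul h1 h2 (hpos n).le (by positivity)
      _ = C * (2 ^ d) ^ β := by field_simp
      _ ≤ _ := by linarith

/-! ### The integral operator on the spherical harmonics -/

section Operator

variable {d : ℕ} {K : C(Sph d × Sph d, ℝ)} {m : ℕ → ℝ}
  {Y : (n : ℕ) → Fin (harmDim d n) → C(Sph d, ℝ)}

theorem intOp_apply (f : L2 d) : intOp K f = toL2 (integralFun K f) := rfl

theorem IsMercerCoeff.inner_sec (hM : IsMercerCoeff K m) (hY : IsHarmonicSystem Y) (n : ℕ)
    (l : Fin (harmDim d n)) (x : Sph d) : ⟪toL2 (Y n l), toL2 (sec K x)⟫_ℝ = m n * Y n l x := by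
  rw [← hM.eigen Y hY, real_inner_comm, inner_toL2]
  rfl

theorem IsMercerCoeff.intOp_eq (hM : IsMercerCoeff K m) (hY : IsHarmonicSystem Y) (n : ℕ)
    (l : Fin (harmDim d n)) : intOp K (toL2 (Y n l)) = m n • toL2 (Y n l) := by
  rw [intOp_apply, ← toL2_smul]
  congr 1
  ext x
  rw [integralFun_apply, real_inner_comm, hM.inner_sec hY]
  rfl

/-- A continuous functional is determined by its values on the orthonormal basis. -/
theorem IsMercerCoeff.ext_functional (hM : IsMercerCoeff K m) (hY : IsHarmonicSystem Y)
    {A B : L2 d →L[ℝ] ℝ} (h : ∀ n l, A (toL2 (Y n l)) = B (toL2 (Y n l))) : A = B :=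
  ContinuousLinearMap.ext_on
    (Submodule.dense_iff_topologicalClosure_eq_top.2 (hM.complete Y hY))
    (by rintro _ ⟨i, rfl⟩; exact h i.1 i.2)

theorem IsMercerCoeff.inner_intOp (hM : IsMercerCoeff K m) (hY : IsHarmonicSystem Y) (n : ℕ)
    (l : Fin (harmDim d n)) (f : L2 d) :
    ⟪toL2 (Y n l), intOp K f⟫_ℝ = m n * ⟪toL2 (Y n l), f⟫_ℝ := by
  have h : (innerSL ℝ (toL2 (Y n l))).comp (intOp K) = m n • innerSL ℝ (toL2 (Y n l)) := by
    refine hM.ext_functional hY fun j k => ?_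
    have ho := orthonormal_iff_ite.1 (hM.orthonormal Y hY) ⟨n, l⟩ ⟨j, k⟩
    simp only at ho
    simp only [ContinuousLinearMap.comp_apply, innerSL_apply_apply, hM.intOp_eq hY,
      inner_smul_right, smul_apply, smul_eq_mul, ho]
    split_ifs with h
    · have hnj : n = j := congrArg Sigma.fst h
      rw [hnj]
    · simp
  exact DFunLike.congr_fun h f

theorem IsMercerCoeff.isSymmetric (hM : IsMercerCoeff K m) :
    (intOp K : L2 d →ₗ[ℝ] L2 d).IsSymmetric := by
  obtain ⟨Y, hY⟩ := hM.exists_system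
  intro f g
  have h : innerSL ℝ (intOp K f) = (innerSL ℝ f).comp (intOp K) := by
    refine hM.ext_functional hY fun j k => ?_
    simp only [ContinuousLinearMap.comp_apply, innerSL_apply_apply, hM.intOp_eq hY,
      inner_smul_right]
    rw [real_inner_comm, hM.inner_intOp hY, real_inner_comm]
  exact DFunLike.congr_fun h g

theorem IsMercerCoeff.eq_zero (hM : IsMercerCoeff K m) (hY : IsHarmonicSystem Y) {f : L2 d}
    (h : ∀ n l, ⟪toL2 (Y n l), f⟫_ℝ = 0) : f = 0 := by
  have h1 : innerSL ℝ f = 0 := hM.ext_functional hY fun n l => by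
    rw [innerSL_apply_apply, real_inner_comm, h]
    rfl
  exact inner_self_eq_zero.1 (DFunLike.congr_fun h1 f)

/-- The operator has no eigenvalues besides the `m n`. -/
theorem IsMercerCoeff.eigenspace_eq_bot (hM : IsMercerCoeff K m) {z : ℝ} (hz : ∀ n, m n ≠ z) :
    Module.End.eigenspace (intOp K : L2 d →ₗ[ℝ] L2 d) z = ⊥ := by
  obtain ⟨Y, hY⟩ := hM.exists_system
  rw [Submodule.eq_bot_iff]
  intro f hf
  rw [Module.End.mem_eigenspace_iff] at hf
  refine hM.eq_zero hY fun n l => ?_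
  have h := hM.inner_intOp hY n l f
  rw [show intOp K f = z • f from hf, inner_smul_right] at h
  by_contra h0
  exact hz n (mul_right_cancel₀ h0 h).symm

/-- The diagonal of the kernel bounds the eigenvalues, by the addition formula. -/
theorem IsMercerCoeff.le_diag (hd : 1 ≤ d) (hM : IsMercerCoeff K m) (n : ℕ) (x : Sph d) :
    m n ≤ K (x, x) := by
  obtain ⟨Y, hY⟩ := hM.exists_system
  have h1 := (hM.tendstoUniformly Y hY).tendsto_at (x, x)
  simp only [← zonal_apply, hY.zonal_self hd] at h1
  have hnn : ∀ j, 0 ≤ m j * harmDim d j := fun j => mul_nonneg (hM.nonneg j) (Nat.cast_nonneg _)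
  have h2 : m n * harmDim d n ≤ K (x, x) :=
    (Finset.single_le_sum (fun j _ => hnn j) (Finset.self_mem_range_succ n)).trans
      (Monotone.ge_of_tendsto (monotone_nat_of_le_succ fun j => by
        rw [Finset.sum_range_succ]
        exact le_add_of_nonneg_right (hnn j)) h1 (n + 1))
  refine le_trans (le_mul_of_one_le_right (hM.nonneg n) ?_) h2
  exact Nat.one_le_cast.2 (harmDim_pos hd n)

/-! ### Eigenvalue decay -/

/-- Comparison of the sorted eigenvalues `ev` with the list ordered by degree: if there are at most
`k` harmonics of degree `< n`, one of the first `k + 1` eigenvalues belongs to a degree `≥ n`; if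
there are more than `k` harmonics with degree in `[n₀, n)`, one of them is not among the
first `k`. -/
theorem IsMercerCoeff.eigenvalueDecay (hd : 1 ≤ d) (hM : IsMercerCoeff K m) {β : ℝ} (hβ : 0 < β)
    (h : Asymptotics.IsTheta atTop m (fun n : ℕ => (n : ℝ) ^ (-((d : ℝ) * β)))) :
    EigenvalueDecay K β := by
  obtain ⟨Y, hY⟩ := hM.exists_system
  obtain ⟨A, hA, n₀, hlow⟩ := exists_lower_bound_of_isTheta hM.nonneg hβ h
  obtain ⟨B, hB, hup⟩ := exists_upper_bound_of_isTheta hM.nonneg hβ h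
  have hpos : ∀ n, n₀ ≤ n → 0 < m n := fun n hn =>
    (by positivity : (0 : ℝ) < A * _).trans_le (hlow n hn)
  let I := {i : Σ n, Fin (harmDim d n) // m i.1 ≠ 0}
  let a : I → ℝ := fun i => m i.1.1
  have ha : ∀ i, 0 < a i := fun i => (hM.nonneg _).lt_of_ne' i.2
  have hinf : Infinite I := by
    refine Infinite.of_injective (fun n : ℕ => (⟨⟨n + n₀, ⟨0, harmDim_pos hd _⟩⟩,
      (hpos _ (Nat.le_add_left _ _)).ne'⟩ : I)) fun n n' hnn => ?_
    have := congrArg (fun i : I => i.1.1) hnn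
    simpa using this
  have hlim : Tendsto m atTop (𝓝 0) := by
    refine h.1.trans_tendsto ?_
    have hdβ : 0 < (d : ℝ) * β := mul_pos (Nat.cast_pos.2 hd) hβ
    exact (tendsto_rpow_neg_atTop hdβ).comp tendsto_natCast_atTop_atTop
  have hfin : ∀ ε > 0, {i : I | ε ≤ a i}.Finite := by
    intro ε hε
    obtain ⟨N, hN⟩ := eventually_atTop.1 (hlim.eventually_lt_const hε)
    refine Set.Finite.of_finite_image (f := Subtype.val) ((idxLT d N).finite_toSet.subset ?_)
      Subtype.val_injective.injOn
    rintro _ ⟨i, hi, rfl⟩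
    refine mem_idxLT.2 (not_le.1 fun hle => ?_)
    exact absurd hi (not_le.2 (hN _ hle))
  obtain ⟨e, he⟩ := exists_equiv_antitone ha hfin
  refine ⟨a ∘ e, fun k => toL2 (Y (e k).1.1 (e k).1.2), he, fun k => ha _,
    (hM.orthonormal Y hY).comp (fun k => (e k).1) (Subtype.val_injective.comp e.injective),
    fun k => hM.intOp_eq hY _ _, fun f hf => hM.eq_zero hY fun n l => ?_, ?_⟩
  · rw [hM.inner_intOp hY]
    by_cases h0 : m n = 0
    · rw [h0, zero_mul]
    · obtain ⟨k, hk⟩ := e.surjective ⟨⟨n, l⟩, h0⟩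
      have : ⟪toL2 (Y (e k).1.1 (e k).1.2), f⟫_ℝ = 0 := hf k
      rw [hk] at this
      rw [this, mul_zero]
  set s₀ := (idxLT d n₀).card with hs₀
  set F := 2 ^ d * (d.factorial * (1 + s₀) + 1) with hF
  have hF0 : (0 : ℝ) < F := by
    have : 0 < F := by positivity
    exact_mod_cast this
  refine ⟨A * (F : ℝ) ^ (-β), B * (1 / 4 : ℝ) ^ (-β), by positivity, by positivity,
    fun k => ⟨?_, ?_⟩⟩
  · -- the least `n` for which more than `k` harmonics have degree in `[n₀, n)`, up to constants
    have hex : ∃ n : ℕ, d.factorial * (k + s₀) < n ^ d :=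
      ⟨d.factorial * (k + s₀) + 1, (Nat.lt_succ_self _).trans_le
        (Nat.le_self_pow (by omega) _)⟩
    obtain ⟨n, hn, hmin⟩ : ∃ n : ℕ, d.factorial * (k + s₀) < n ^ d ∧
        n ^ d ≤ F * (k + 1) := by
      classical
      refine ⟨Nat.find hex, Nat.find_spec hex, ?_⟩
      obtain ⟨r, hr⟩ : ∃ r, Nat.find hex = r + 1 := Nat.exists_eq_succ_of_ne_zero fun h0 => by
        have := Nat.find_spec hex
        rw [h0, zero_pow (by omega)] at this
        omega
      have h1 : r ^ d ≤ d.factorial * (k + s₀) := not_lt.1 (Nat.find_min hex (by omega))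
      have h2 : (r + 1) ^ d ≤ 2 ^ d * (r ^ d + 1) := by
        rcases Nat.eq_zero_or_pos r with rfl | hr0
        · simp [zero_pow (by omega : d ≠ 0), Nat.one_le_two_pow]
        · calc (r + 1) ^ d ≤ (2 * r) ^ d := Nat.pow_le_pow_left (by omega) _
            _ = 2 ^ d * r ^ d := mul_pow _ _ _
            _ ≤ _ := Nat.mul_le_mul_left _ (Nat.le_succ _)
      rw [hr]
      refine h2.trans ?_
      rw [hF, mul_assoc]
      refine Nat.mul_le_mul_left _ ?_
      have h3 : d.factorial * (k + s₀) ≤ d.factorial * ((1 + s₀) * (k + 1)) :=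
        Nat.mul_le_mul_left _ (by nlinarith)
      nlinarith
    have hcard : k + s₀ < (idxLT d n).card := by
      rw [card_idxLT]
      exact lt_of_mul_lt_mul_left (hn.trans_le (pow_le_factorial_mul_sum_harmDim hd n))
        (Nat.zero_le _)
    obtain ⟨j, hkj, hj⟩ : ∃ j, k ≤ j ∧ (e j).1 ∈ idxLT d n \ idxLT d n₀ := by
      classical
      by_contra! hcon
      have hsub : idxLT d n \ idxLT d n₀ ⊆ (Finset.range k).image fun j => (e j).1 := by
        intro i hi
        have hi' : n₀ ≤ i.1 := not_lt.1 fun hlt => (Finset.mem_sdiff.1 hi).2 (mem_idxLT.2 hlt)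
        refine Finset.mem_image.2 ⟨e.symm ⟨i, (hpos _ hi').ne'⟩, Finset.mem_range.2 ?_, by simp⟩
        by_contra! hle
        exact hcon _ hle (by simpa using hi)
      have h1 := (Finset.card_le_card hsub).trans Finset.card_image_le
      have h2 := Finset.le_card_sdiff (idxLT d n₀) (idxLT d n)
      rw [Finset.card_range] at h1
      omega
    rw [Finset.mem_sdiff, mem_idxLT, mem_idxLT, not_lt] at hj
    have h1 : A * ((((e j).1.1 : ℝ) + 1) ^ d) ^ (-β) ≤ a (e k) := (hlow _ hj.2).trans (he hkj)
    refine le_trans ?_ h1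
    rw [mul_assoc, ← Real.mul_rpow hF0.le (by positivity)]
    refine mul_le_mul_of_nonneg_left ?_ hA.le
    refine Real.rpow_le_rpow_of_nonpos (by positivity) ?_ (by linarith)
    have h2 : ((e j).1.1 + 1) ^ d ≤ F * (k + 1) := (Nat.pow_le_pow_left hj.1 d).trans hmin
    exact_mod_cast h2
  · -- the largest `n` for which at most `k` harmonics have degree `< n`, up to constants
    have hex : ∃ n : ℕ, k < 2 * (n + 1) ^ d :=
      ⟨k, by have := Nat.le_self_pow (show d ≠ 0 by omega) (k + 1); omega⟩
    obtain ⟨n, hn, hmin⟩ : ∃ n : ℕ, k < 2 * (n + 1) ^ d ∧ 2 * n ^ d ≤ k := by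
      classical
      refine ⟨Nat.find hex, Nat.find_spec hex, ?_⟩
      rcases hr : Nat.find hex with _ | r
      · simp [zero_pow (by omega : d ≠ 0)]
      · exact not_lt.1 (Nat.find_min hex (by omega))
    have hcard : (idxLT d n).card ≤ k := by
      rw [card_idxLT]
      exact (sum_harmDim_le d n).trans hmin
    obtain ⟨j, hjk, hj⟩ : ∃ j, j ≤ k ∧ n ≤ (e j).1.1 := by
      classical
      by_contra! hcon
      have h1 : ((Finset.range (k + 1)).image fun j => (e j).1).card ≤ (idxLT d n).card := by
        refine Finset.card_le_card fun i hi => ?_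
        obtain ⟨j, hj, rfl⟩ := Finset.mem_image.1 hi
        exact mem_idxLT.2 (hcon j (Nat.lt_succ_iff.1 (Finset.mem_range.1 hj)))
      have hinj : Function.Injective fun j => (e j).1 := Subtype.val_injective.comp e.injective
      rw [Finset.card_image_of_injective _ hinj, Finset.card_range] at h1
      omega
    have h1 : a (e k) ≤ B * ((((e j).1.1 : ℝ) + 1) ^ d) ^ (-β) := (he hjk).trans (hup _)
    refine h1.trans ?_
    rw [mul_assoc, ← Real.mul_rpow (by norm_num) (by positivity)]
    refine mul_le_mul_of_nonneg_left ?_ hB.le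
    refine Real.rpow_le_rpow_of_nonpos (by positivity) ?_ (by linarith)
    have h2 : k + 1 ≤ 4 * ((e j).1.1 + 1) ^ d := by
      have h3 := Nat.pow_le_pow_left (Nat.succ_le_succ hj) d
      simp only [Nat.succ_eq_add_one] at h3
      omega
    have h4 : ((k : ℝ) + 1) ≤ 4 * (((e j).1.1 : ℝ) + 1) ^ d := by exact_mod_cast h2
    linarith

end Operator

section Variance

/-! ### The functional calculus -/

/-- Projections onto the members of an orthogonal family, with bounded coefficients on the
nonzero members, are summable: their squared norms obey Bessel's inequality. -/
theorem summable_smul_starProjection {E ι : Type*} [NormedAddCommGroup E]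
    [InnerProductSpace ℝ E] [CompleteSpace E] {V : ι → Submodule ℝ E}
    [∀ i, (V i).HasOrthogonalProjection]
    (hV : OrthogonalFamily ℝ (fun i => V i) fun i => (V i).subtypeₗᵢ) {φ : ι → ℝ} {B : ℝ}
    (hB : ∀ i, V i ≠ ⊥ → |φ i| ≤ B) (f : E) :
    Summable fun i => φ i • (V i).starProjection f := by
  have h1 : Summable fun i => ‖(V i).starProjection f‖ ^ 2 := by
    refine summable_of_sum_le (c := ‖f‖ ^ 2) (fun i => sq_nonneg _) fun s => ?_
    have h2 : ‖∑ i ∈ s, (V i).starProjection f‖ ^ 2 = ∑ i ∈ s, ‖(V i).starProjection f‖ ^ 2 :=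
      hV.norm_sum (fun i => (V i).orthogonalProjectionOnto f) s
    have h3 : ⟪f, ∑ i ∈ s, (V i).starProjection f⟫_ℝ = ∑ i ∈ s, ‖(V i).starProjection f‖ ^ 2 := by
      rw [inner_sum]
      refine Finset.sum_congr rfl fun i _ => ?_
      rw [← real_inner_self_eq_norm_sq, Submodule.inner_starProjection_left_eq_right,
        (V i).starProjection_eq_self_iff.2 ((V i).starProjection_apply_mem f)]
    have h4 := sq_nonneg ‖f - ∑ i ∈ s, (V i).starProjection f‖
    rw [norm_sub_sq_real, h2, h3] at h4
    linarith
  have h5 : Summable fun i => ‖φ i • (V i).starProjection f‖ ^ 2 := by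
    refine Summable.of_nonneg_of_le (fun i => sq_nonneg _) (fun i => ?_) (h1.mul_left (B ^ 2))
    by_cases hi : V i = ⊥
    · have h6 : (V i).starProjection f ∈ (⊥ : Submodule ℝ E) :=
        hi ▸ (V i).starProjection_apply_mem f
      simp [(Submodule.mem_bot ℝ).1 h6]
    · rw [norm_smul, mul_pow, Real.norm_eq_abs]
      exact mul_le_mul_of_nonneg_right (pow_le_pow_left₀ (abs_nonneg _) (hB i hi) 2) (sq_nonneg _)
  exact (hV.summable_iff_norm_sq_summable fun i => φ i • (V i).orthogonalProjectionOnto f).2 h5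

variable {d : ℕ} {K : C(Sph d × Sph d, ℝ)} {m : ℕ → ℝ}
  {Y : (n : ℕ) → Fin (harmDim d n) → C(Sph d, ℝ)}

/-- The functional calculus multiplies the coefficient at `Y_{n,l}` by `φ(μ_n)`. The bound on `φ`
makes the series that defines `φ(T) f` summable. -/
theorem IsMercerCoeff.inner_funcCalc (hM : IsMercerCoeff K m) (hY : IsHarmonicSystem Y)
    {φ : ℝ → ℝ} {B : ℝ} (hB : ∀ n, |φ (m n)| ≤ B) (f : L2 d) (n : ℕ) (l : Fin (harmDim d n)) :
    ⟪toL2 (Y n l), funcCalc φ (intOp K) f⟫_ℝ = φ (m n) * ⟪toL2 (Y n l), f⟫_ℝ := by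
  have hO := hM.isSymmetric.orthogonalFamily_eigenspaces
  have hs := summable_smul_starProjection (φ := φ) (B := B) hO (fun z hz => by
    by_contra hc
    exact hz (hM.eigenspace_eq_bot fun j hj => hc (hj ▸ hB j))) f
  have hmem : toL2 (Y n l) ∈ Module.End.eigenspace (intOp K : L2 d →ₗ[ℝ] L2 d) (m n) :=
    Module.End.mem_eigenspace_iff.2 (hM.intOp_eq hY n l)
  have h1 : HasSum (fun z : ℝ => ⟪toL2 (Y n l), φ z •
      (Module.End.eigenspace (intOp K : L2 d →ₗ[ℝ] L2 d) z).starProjection f⟫_ℝ)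
      ⟪toL2 (Y n l), funcCalc φ (intOp K) f⟫_ℝ := hs.hasSum.mapL (innerSL ℝ (toL2 (Y n l)))
  refine h1.unique ?_
  have h2 : φ (m n) * ⟪toL2 (Y n l), f⟫_ℝ = ⟪toL2 (Y n l), φ (m n) •
      (Module.End.eigenspace (intOp K : L2 d →ₗ[ℝ] L2 d) (m n)).starProjection f⟫_ℝ := by
    rw [inner_smul_right, ← Submodule.inner_starProjection_left_eq_right,
      Submodule.starProjection_eq_self_iff.2 hmem]
  rw [h2]
  refine hasSum_single (m n) fun z hz => ?_
  rw [inner_smul_right]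
  have h3 := hO hz.symm ⟨_, hmem⟩ ⟨_, Submodule.starProjection_apply_mem
    (Module.End.eigenspace (intOp K : L2 d →ₗ[ℝ] L2 d) z) f⟩
  have h4 : ⟪toL2 (Y n l), (Module.End.eigenspace (intOp K : L2 d →ₗ[ℝ] L2 d) z).starProjection f⟫_ℝ
      = 0 := h3
  rw [h4, mul_zero]

/-- Bessel's inequality for `φ(T) k_x`, combined with the addition formula. -/
theorem IsMercerCoeff.le_covC (hd : 1 ≤ d) (hM : IsMercerCoeff K m) {φ : ℝ → ℝ} {B : ℝ}
    (hB : ∀ n, |φ (m n)| ≤ B) (σ : ℝ) (x : Sph d) (s : Finset ℕ) :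
    σ ^ 2 * ∑ n ∈ s, (φ (m n) * m n) ^ 2 * harmDim d n ≤ covC K σ φ x x := by
  obtain ⟨Y, hY⟩ := hM.exists_system
  have h1 : covC K σ φ x x = σ ^ 2 * ‖funcCalc φ (intOp K) (toL2 (sec K x))‖ ^ 2 := by
    rw [covC, ← real_inner_self_eq_norm_sq, L2.inner_def]
    rfl
  rw [h1]
  refine mul_le_mul_of_nonneg_left ?_ (sq_nonneg σ)
  refine le_trans (le_of_eq ?_) ((hM.orthonormal Y hY).sum_inner_products_le
    (funcCalc φ (intOp K) (toL2 (sec K x))) (s := s.sigma fun _ => Finset.univ))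
  rw [Finset.sum_sigma]
  refine Finset.sum_congr rfl fun n _ => ?_
  rw [← hY.zonal_self hd n x, zonal_apply, Finset.mul_sum]
  refine Finset.sum_congr rfl fun l _ => ?_
  rw [hM.inner_funcCalc hY hB, hM.inner_sec hY, Real.norm_eq_abs, sq_abs]
  ring

/-! ### The variance lower bound -/

theorem filterCon_mul_self (t z : ℝ) : filterCon t z * z = 1 - Real.exp (-(t * z)) := by
  unfold filterCon
  split_ifs with h
  · simp [h]
  · field_simp

theorem filterDis_mul_self (η t z : ℝ) : filterDis η t z * z = 1 - (1 - η * z) ^ (t / η) := by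
  unfold filterDis
  split_ifs with h
  · simp [h]
  · field_simp

theorem abs_filterCon_le {t z : ℝ} (ht : 0 ≤ t) (hz : 0 ≤ z) : |filterCon t z| ≤ t := by
  unfold filterCon
  split_ifs with h
  · exact (abs_of_nonneg ht).le
  · have hz' : 0 < z := hz.lt_of_ne' h
    have h1 := Real.one_sub_le_exp_neg (t * z)
    have h2 : Real.exp (-(t * z)) ≤ 1 := Real.exp_le_one_iff.2 (by nlinarith)
    rw [abs_of_nonneg (div_nonneg (by linarith) hz), div_le_iff₀ hz']
    linarith

/-- The discrete filter is bounded for fixed `η` and `t`. The bound `t` of the continuous filter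
fails here when `t < η`. -/
theorem abs_filterDis_le {η t z : ℝ} (hη : 0 < η) (ht : 0 < t) (hz : 0 ≤ z) (h1 : η * z < 1) :
    |filterDis η t z| ≤ max (t / η) 1 * η := by
  unfold filterDis
  split_ifs with h
  · rw [abs_of_pos ht]
    calc t = t / η * η := by field_simp
      _ ≤ _ := mul_le_mul_of_nonneg_right (le_max_left _ _) hη.le
  · have hz' : 0 < z := hz.lt_of_ne' h
    have hb : 0 < 1 - η * z := by linarith
    have hb1 : 1 - η * z ≤ 1 := by nlinarith
    have h2 : (1 - η * z) ^ (t / η) ≤ 1 := Real.rpow_le_one hb.le hb1 (by positivity)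
    -- Bernoulli's inequality, after raising the exponent to at least one
    have h3 : 1 + max (t / η) 1 * -(η * z) ≤ (1 - η * z) ^ (t / η) := by
      refine (one_add_mul_self_le_rpow_one_add (s := -(η * z)) (by linarith)
        (le_max_right (t / η) 1)).trans ?_
      rw [← sub_eq_add_neg]
      exact Real.rpow_le_rpow_of_exponent_ge hb hb1 (le_max_left _ _)
    rw [abs_of_nonneg (div_nonneg (by linarith) hz), div_le_iff₀ hz']
    linarith

/-- The discrete filter dominates the continuous one, since `1 - ηz ≤ e^(-ηz)`. -/
theorem one_sub_exp_le_one_sub_rpow {η t z : ℝ} (hη : 0 < η) (ht : 0 ≤ t) (h1 : η * z < 1) :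
    1 - Real.exp (-(t * z)) ≤ 1 - (1 - η * z) ^ (t / η) := by
  have h2 : (1 - η * z) ^ (t / η) ≤ Real.exp (-(η * z)) ^ (t / η) :=
    Real.rpow_le_rpow (by linarith) (Real.one_sub_le_exp_neg _) (by positivity)
  rw [← Real.exp_mul] at h2
  have h3 : -(η * z) * (t / η) = -(t * z) := by field_simp
  rw [h3] at h2
  linarith

/-- The effective number of eigenvalues above `1 / t` is at least of order `t^(1/β)`. For bounded
`t` this is witnessed by the single degree `n₀`, for large `t` by all degrees `n ≥ n₀` with
`(n + 1)^d ≤ (A t)^(1/β)`, for which `t m_n ≥ 1`. -/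
theorem exists_sum_one_sub_exp_ge (hd : 1 ≤ d) (h0 : ∀ n, 0 ≤ m n) {β : ℝ} (hβ : 0 < β)
    (h : Asymptotics.IsTheta atTop m (fun n : ℕ => (n : ℝ) ^ (-((d : ℝ) * β)))) {t₀ : ℝ}
    (ht₀ : 0 < t₀) : ∃ c : ℝ, 0 < c ∧ ∀ t, t₀ ≤ t → ∃ s : Finset ℕ,
      c * t ^ (1 / β) ≤ ∑ n ∈ s, (1 - Real.exp (-(t * m n))) ^ 2 * harmDim d n := by
  obtain ⟨A, hA, n₀, hlow⟩ := exists_lower_bound_of_isTheta h0 hβ h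
  have hpos : 0 < m n₀ := (by positivity : (0 : ℝ) < A * _).trans_le (hlow n₀ le_rfl)
  set s₀ := (idxLT d n₀).card with hs₀
  -- beyond the threshold `X₀` for `X = (A t)^(1/β)`, the degrees `< n₀` do not matter
  set X₀ : ℝ := 2 ^ (d + 1) * d.factorial * (s₀ + 1) with hX₀
  have hX₀0 : 0 < X₀ := by positivity
  set δ := (1 - Real.exp (-(t₀ * m n₀))) ^ 2 with hδ
  have hδ0 : 0 < δ := by
    have : Real.exp (-(t₀ * m n₀)) < 1 := Real.exp_lt_one_iff.2 (by nlinarith)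
    exact pow_pos (by linarith) 2
  refine ⟨min (A ^ (1 / β) / (2 ^ (d + 3) * d.factorial)) (δ * A ^ (1 / β) / X₀),
    lt_min (by positivity) (by positivity), fun t ht => ?_⟩
  have ht0 : 0 < t := ht₀.trans_le ht
  have hX : A ^ (1 / β) * t ^ (1 / β) = (A * t) ^ (1 / β) := (Real.mul_rpow hA.le ht0.le).symm
  set X := (A * t) ^ (1 / β) with hXdef
  have hX0 : 0 < X := by positivity
  have hT0 : 0 < t ^ (1 / β) := by positivity
  rcases le_or_gt X X₀ with hXX | hXX
  · refine ⟨{n₀}, ?_⟩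
    rw [Finset.sum_singleton]
    calc min (A ^ (1 / β) / (2 ^ (d + 3) * d.factorial)) (δ * A ^ (1 / β) / X₀) * t ^ (1 / β)
        ≤ δ * A ^ (1 / β) / X₀ * t ^ (1 / β) :=
          mul_le_mul_of_nonneg_right (min_le_right _ _) hT0.le
      _ = δ * (X / X₀) := by rw [← hX]; ring
      _ ≤ δ * 1 := mul_le_mul_of_nonneg_left ((div_le_one hX₀0).2 hXX) hδ0.le
      _ ≤ (1 - Real.exp (-(t * m n₀))) ^ 2 * harmDim d n₀ := by
        refine mul_le_mul ?_ (Nat.one_le_cast.2 (harmDim_pos hd n₀)) zero_le_one (sq_nonneg _)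
        have h1 : Real.exp (-(t * m n₀)) ≤ Real.exp (-(t₀ * m n₀)) :=
          Real.exp_le_exp.2 (by nlinarith)
        have h2 : Real.exp (-(t₀ * m n₀)) < 1 := Real.exp_lt_one_iff.2 (by nlinarith)
        exact pow_le_pow_left₀ (by linarith) (by linarith) 2
  · -- `M` is the largest degree with `(M + 1)^d ≤ X`
    obtain ⟨M, hM, hM'⟩ : ∃ M : ℕ, ((M : ℝ) + 1) ^ d ≤ X ∧ X < ((M : ℝ) + 1 + 1) ^ d := by
      classical
      have hex : ∃ M : ℕ, X < ((M : ℝ) + 1 + 1) ^ d := by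
        obtain ⟨M, hM⟩ := exists_nat_gt X
        refine ⟨M, hM.trans_le ?_⟩
        exact (by linarith : (M : ℝ) ≤ (M : ℝ) + 1 + 1).trans
          (le_self_pow₀ (by linarith [Nat.cast_nonneg (α := ℝ) M]) (by omega))
      refine ⟨Nat.find hex, ?_, Nat.find_spec hex⟩
      rcases hr : Nat.find hex with _ | r
      · have h1 : (1 : ℝ) ≤ X₀ := by
          have h2 : (1 : ℝ) ≤ 2 ^ (d + 1) := one_le_pow₀ (by norm_num)
          have h3 : (1 : ℝ) ≤ d.factorial := Nat.one_le_cast.2 d.factorial_pos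
          have h4 : (1 : ℝ) ≤ s₀ + 1 := by linarith [Nat.cast_nonneg (α := ℝ) s₀]
          exact one_le_mul_of_one_le_of_one_le (one_le_mul_of_one_le_of_one_le h2 h3) h4
        simp
        linarith
      · have := not_lt.1 (Nat.find_min hex (show r < Nat.find hex by omega))
        push_cast
        exact this
    refine ⟨Finset.range (M + 1) \ Finset.range n₀, ?_⟩
    have hterm : ∀ n ∈ Finset.range (M + 1) \ Finset.range n₀,
        1 / 4 * (harmDim d n : ℝ) ≤ (1 - Real.exp (-(t * m n))) ^ 2 * harmDim d n := by
      intro n hn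
      rw [Finset.mem_sdiff, Finset.mem_range, Finset.mem_range, not_lt] at hn
      refine mul_le_mul_of_nonneg_right ?_ (Nat.cast_nonneg _)
      have h1 : ((n : ℝ) + 1) ^ d ≤ X := by
        refine le_trans (pow_le_pow_left₀ (by positivity) ?_ d) hM
        have : (n : ℝ) ≤ M := Nat.cast_le.2 (by omega)
        linarith
      have h2 : 1 ≤ t * m n := by
        have h3 : X ^ (-β) ≤ (((n : ℝ) + 1) ^ d) ^ (-β) :=
          Real.rpow_le_rpow_of_nonpos (by positivity) h1 (by linarith)
        have h4 : X ^ (-β) = (A * t)⁻¹ := by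
          rw [hXdef, ← Real.rpow_mul (by positivity), ← Real.rpow_neg_one]
          congr 1
          field_simp
        have h5 := (mul_le_mul_of_nonneg_left (h4 ▸ h3) hA.le).trans (hlow n hn.2)
        have h6 := mul_le_mul_of_nonneg_left h5 ht0.le
        have h7 : t * (A * (A * t)⁻¹) = 1 := by field_simp
        linarith
      have h8 : Real.exp (-(t * m n)) ≤ 1 / 2 := by
        have h9 : Real.exp (-(t * m n)) ≤ Real.exp (-1) := Real.exp_le_exp.2 (by linarith)
        have h10 := Real.exp_neg_one_lt_d9
        linarith
      nlinarith
    refine le_trans ?_ (Finset.sum_le_sum hterm)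
    rw [← Finset.mul_sum]
    have hcard : (((M : ℝ) + 1) ^ d) ≤ d.factorial *
        (∑ n ∈ Finset.range (M + 1) \ Finset.range n₀, (harmDim d n : ℝ) + s₀) := by
      have h1 := pow_le_factorial_mul_sum_harmDim hd (M + 1)
      have h2 : ∑ n ∈ Finset.range (M + 1), harmDim d n ≤
          ∑ n ∈ Finset.range (M + 1) \ Finset.range n₀, harmDim d n + s₀ := by
        rw [hs₀, card_idxLT, ← Finset.sum_union Finset.sdiff_disjoint]
        exact Finset.sum_le_sum_of_subset (by simp)
      have h3 := h1.trans (Nat.mul_le_mul_left _ h2)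
      exact_mod_cast h3
    have h2d : ((M : ℝ) + 1 + 1) ^ d ≤ 2 ^ d * ((M : ℝ) + 1) ^ d := by
      rw [← mul_pow]
      exact pow_le_pow_left₀ (by positivity) (by linarith [Nat.cast_nonneg (α := ℝ) M]) d
    set S := ∑ n ∈ Finset.range (M + 1) \ Finset.range n₀, (harmDim d n : ℝ)
    have hfac : (0 : ℝ) < d.factorial := Nat.cast_pos.2 d.factorial_pos
    have hXS : X ≤ 2 ^ d * d.factorial * (S + s₀) := by
      refine hM'.le.trans (h2d.trans ?_)
      rw [mul_assoc]
      exact mul_le_mul_of_nonneg_left hcard (by positivity)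
    have hs : 2 * (2 ^ d * d.factorial * s₀) ≤ X := by
      refine le_trans ?_ hXX.le
      rw [hX₀, pow_succ]
      have : (0 : ℝ) < 2 ^ d * d.factorial := by positivity
      nlinarith
    calc min (A ^ (1 / β) / (2 ^ (d + 3) * d.factorial)) (δ * A ^ (1 / β) / X₀) * t ^ (1 / β)
        ≤ A ^ (1 / β) / (2 ^ (d + 3) * d.factorial) * t ^ (1 / β) :=
          mul_le_mul_of_nonneg_right (min_le_left _ _) hT0.le
      _ = X / (2 ^ (d + 3) * d.factorial) := by rw [← hX]; ring
      _ ≤ 1 / 4 * S := by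
        rw [div_le_iff₀ (by positivity), pow_add]
        nlinarith

theorem IsMercerCoeff.varianceLowerBound (hd : 1 ≤ d) (hM : IsMercerCoeff K m) {β : ℝ} (hβ : 0 < β)
    (h : Asymptotics.IsTheta atTop m (fun n : ℕ => (n : ℝ) ^ (-((d : ℝ) * β)))) :
    VarianceLowerBound K β := by
  intro t₀ ht₀
  obtain ⟨c, hc, hsum⟩ := exists_sum_one_sub_exp_ge hd hM.nonneg hβ h ht₀
  refine ⟨c, hc, fun σ t x ht => ?_⟩
  have ht0 : 0 < t := ht₀.trans_le ht
  obtain ⟨s, hs⟩ := hsum t ht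
  have key : ∀ (φ : ℝ → ℝ) (B : ℝ), (∀ n, |φ (m n)| ≤ B) →
      (∀ n, 1 - Real.exp (-(t * m n)) ≤ φ (m n) * m n) →
      c * σ ^ 2 * t ^ (1 / β) ≤ covC K σ φ x x := by
    intro φ B hB hφ
    refine le_trans ?_ (hM.le_covC hd hB σ x s)
    rw [mul_comm c, mul_assoc]
    refine mul_le_mul_of_nonneg_left (hs.trans (Finset.sum_le_sum fun n _ => ?_)) (sq_nonneg σ)
    refine mul_le_mul_of_nonneg_right (pow_le_pow_left₀ ?_ (hφ n) 2) (Nat.cast_nonneg _)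
    have := Real.exp_le_one_iff.2 (neg_nonpos.2 (mul_nonneg ht0.le (hM.nonneg n)))
    linarith
  refine ⟨key _ t (fun n => abs_filterCon_le ht0.le (hM.nonneg n))
    fun n => (filterCon_mul_self _ _).ge, fun κ η hκ hκK hη hηκ => ?_⟩
  have hlt : ∀ n, η * m n < 1 := by
    intro n
    have h1 : m n ≤ κ ^ 2 := (hM.le_diag hd n x).trans (hκK x)
    have h2 : η * (2 * κ ^ 2) < 1 := (lt_div_iff₀ (by positivity)).1 hηκ
    have h3 := mul_le_mul_of_nonneg_left h1 hη.le
    have h4 : 0 < η * κ ^ 2 := by positivity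
    linarith
  refine key _ _ (fun n => abs_filterDis_le hη ht0 (hM.nonneg n) (hlt n)) fun n => ?_
  rw [filterDis_mul_self]
  exact one_sub_exp_le_one_sub_rpow hη ht0.le (hlt n)

end Variance

end SphereKernel

end

open SphereKernel
theorem mainTheorem8 (d : ℕ) (hd : 1 ≤ d) (K : C(Sph d × Sph d, ℝ))
    (hK : IsInnerProductKernel K) :
    (∃ m : ℕ → ℝ, IsMercerCoeff K m) ∧
      ∀ m : ℕ → ℝ, IsMercerCoeff K m → ∀ β : ℝ, 1 < β →
        Asymptotics.IsTheta atTop m (fun n : ℕ => (n : ℝ) ^ (-((d : ℝ) * β))) →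
          EigenvalueDecay K β ∧ VarianceLowerBound K β :=
  ⟨exists_isMercerCoeff hd hK, fun _ hM _ hβ h =>
    ⟨hM.eigenvalueDecay hd (zero_lt_one.trans hβ) h,
      hM.varianceLowerBound hd (zero_lt_one.trans hβ) h⟩⟩
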